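/- **Lemma 2.4 (Bernstein inequalities in Lorentz spaces).** Let $n\ge 1$. For a measurable $f:\mathbb{R}^n\to\mathbb{C}$ put $f_*(s)=|\{x:|f(x)|>s\}|$, $f^*(t)=\inf\{s>0: f_*(s)\le t\}$, and, for $p,q\in(0,\infty]$, $$\|f\|_{L^{p,q}}=\Big(\int_0^\infty \big(t^{1/p}f^*(t)\big)^q\,\frac{dt}{t}\Big)^{1/q}\ (q<\infty),\qquad \|f\|_{L^{p,\infty}}=\sup_{t>0}t^{1/p}f^*(t);$$ $L^{p,q}(\mathbb{R}^n)$ is the set of measurable $f$ with $\|f\|_{L^{p,q}}<\infty$. Let $0<R<\infty$, $0<r_1<r_2<\infty$, $B=\{\xi\in\mathbb{R}^n:|\xi|\le R\}$, $\mathcal{C}=\{\xi\in\mathbb{R}^n:r_1\le|\xi|\le r_2\}$, $\lambda B=\{|\xi|\le\lambda R\}$, $\lambda\mathcal{C}=\{\lambda r_1\le|\xi|\le\lambda r_2\}$, and let $k\ge0$ be an integer. Every function in $L^{p,l}(\mathbb{R}^n)$ with $1<p\le\infty$, $0<l\le\infty$ is a tempered distribution, so that its Fourier transform $\widehat u$ and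 its distributional derivatives $\partial^\alpha u$ are defined. Moreover: 1. If $1<p\le\infty$, there is $C=C(n,k,R,p)>0$ such that for all $\lambda>0$ and all $u\in L^{p,\infty}(\mathbb{R}^n)$ with $\operatorname{supp}\widehat u\subset\lambda B$, $$\sup_{|\alpha|=k}\|\partial^\alpha u\|_{L^\infty}\le C\lambda^{k+\frac np}\|u\|_{L^{p,\infty}}.$$ 2. If $1<p<q<\infty$, there is $C=C(n,k,R,p,q)>0$ such that for all $\lambda>0$ and all $u\in L^{p,\infty}(\mathbb{R}^n)$ with $\operatorname{supp}\widehat u\subset\lambda B$, $$\sup_{|\alpha|=k}\|\partial^\alpha u\|_{L^{q,1}}\le C\lambda^{k+n(\frac1p-\frac1q)}\|u\|_{L^{p,\infty}}.$$ 3. If $1<q<\infty$ and $0<l\le\infty$, there is $C=C(n,k,R,q,l)>0$ such that for all $\lambda>0$ and all $u$ with $\operatorname{supp}\widehat u\subset\lambda B$ that lie in $L^{q,l}(\mathbb{R}^n)$, or in $L^{p,\infty}(\mathbb{R}^n)$ for some $1<p<q$, $$\sup_{|\alpha|=k}\|\partial^\alpha u\|_{L^{q,l}}\le C\lambda^{k}\|u\|_{L^{q,l}}.$$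 4. If $1<q<\infty$ and $0<l\le\infty$, there is $C=C(n,k,r_1,r_2,q,l)>0$ such that for all $\lambda>0$ and all $u$ with $\operatorname{supp}\widehat u\subset\lambda\mathcal{C}$ that lie in $L^{q,l}(\mathbb{R}^n)$, or in $L^{p,\infty}(\mathbb{R}^n)$ for some $1<p<q$, $$C^{-1}\lambda^k\|u\|_{L^{q,l}}\le\sup_{|\alpha|=k}\|\partial^\alpha u\|_{L^{q,l}}\le C\lambda^{k}\|u\|_{L^{q,l}}.$$ The norms take values in $[0,\infty]$, and the norm of a distribution that is not a function is $\infty$; thus a finite right-hand side of an upper bound means in particular that $\partial^\alpha u$ is a function in the space on the left. -/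

import Mathlib

open MeasureTheory SchwartzMap
open scoped ENNReal FourierTransform LineDeriv

namespace LorentzBernstein

noncomputable section

section Lorentz

variable {X : Type*} [MeasurableSpace X]

/-- The distribution function `f_*(s) = μ {x : |f x| > s}`. -/
def distribFun (μ : Measure X) (f : X → ℂ) (s : ℝ≥0∞) : ℝ≥0∞ :=
  μ {x | s < ‖f x‖ₑ}

/-- The decreasing rearrangement `f^*(t) = inf {s > 0 : f_*(s) ≤ t}`. The value `s = ∞` always
belongs to the set, so that the infimum is `∞` when no finite `s` qualifies. -/
def rearrangement (μ : Measure X) (f : X → ℂ) (t : ℝ≥0∞) : ℝ≥0∞ :=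
  sInf {s : ℝ≥0∞ | 0 < s ∧ distribFun μ f s ≤ t}

/-- The Lorentz quasi-norm `‖f‖_{L^{p,q}}`, for `p, q ∈ (0, ∞]` (with `1 / ∞ = 0`):
`(∫_0^∞ (t^{1/p} f^*(t))^q dt / t)^{1/q}` if `q < ∞`, and `sup_{t > 0} t^{1/p} f^*(t)` if `q = ∞`.
It takes values in `[0, ∞]`. -/
def lorentzNorm (p q : ℝ≥0∞) (μ : Measure X) (f : X → ℂ) : ℝ≥0∞ :=
  if q = ∞ then
    ⨆ t : ℝ, ⨆ _ : 0 < t,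
      ENNReal.ofReal t ^ (p⁻¹).toReal * rearrangement μ f (ENNReal.ofReal t)
  else
    (∫⁻ t in Set.Ioi (0 : ℝ),
      (ENNReal.ofReal t ^ (p⁻¹).toReal * rearrangement μ f (ENNReal.ofReal t)) ^ q.toReal
        / ENNReal.ofReal t) ^ (q.toReal)⁻¹

/-- `f` belongs to the Lorentz space `L^{p,q}`. -/
def MemLorentz (p q : ℝ≥0∞) (μ : Measure X) (f : X → ℂ) : Prop :=
  AEStronglyMeasurable f μ ∧ lorentzNorm p q μ f < ∞

end Lorentz

section Distributions

variable {n : ℕ}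

/-- The tempered distribution `T` is the function `f`:  `T φ = ∫ φ f` for all Schwartz `φ`, the
integrals being absolutely convergent. Such an `f` is unique almost everywhere. -/
def IsGivenBy (T : 𝓢'(EuclideanSpace ℝ (Fin n), ℂ)) (f : EuclideanSpace ℝ (Fin n) → ℂ) : Prop :=
  ∀ φ : 𝓢(EuclideanSpace ℝ (Fin n), ℂ),
    Integrable (fun x => φ x * f x) volume ∧ T φ = ∫ x, φ x * f x

/-- The (quasi-)norm `N` on functions, extended to tempered distributions: it is `N f` if `T` is
the function `f`, and `∞` if `T` is not a function. (`N f` depends on `f` only up to null sets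
for the norms used here, so that all members of the infimum agree.) -/
def distNorm (N : (EuclideanSpace ℝ (Fin n) → ℂ) → ℝ≥0∞)
    (T : 𝓢'(EuclideanSpace ℝ (Fin n), ℂ)) : ℝ≥0∞ :=
  ⨅ f : EuclideanSpace ℝ (Fin n) → ℂ, ⨅ _ : IsGivenBy T f, N f

/-- `‖T‖_{L^∞(ℝⁿ)}`. -/
def distLinfty (T : 𝓢'(EuclideanSpace ℝ (Fin n), ℂ)) : ℝ≥0∞ :=
  distNorm (fun f => eLpNorm f ∞ volume) T

/-- `‖T‖_{L^{p,q}(ℝⁿ)}`. -/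
def distLorentz (p q : ℝ≥0∞) (T : 𝓢'(EuclideanSpace ℝ (Fin n), ℂ)) : ℝ≥0∞ :=
  distNorm (lorentzNorm p q volume) T

/-- The distributional partial derivative `∂^α T = ∂_1^{α_1} ⋯ ∂_n^{α_n} T`. -/
def multiDeriv (α : Fin n → ℕ) (T : 𝓢'(EuclideanSpace ℝ (Fin n), ℂ)) :
    𝓢'(EuclideanSpace ℝ (Fin n), ℂ) :=
  (List.finRange n).foldr
    (fun i S => (fun S' : 𝓢'(EuclideanSpace ℝ (Fin n), ℂ) =>
      (∂_{EuclideanSpace.single i (1 : ℝ)} S' : 𝓢'(EuclideanSpace ℝ (Fin n), ℂ)))^[α i] S) T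

/-- `sup_{|α| = k} N (∂^α T)`. -/
def supDeriv (k : ℕ) (N : 𝓢'(EuclideanSpace ℝ (Fin n), ℂ) → ℝ≥0∞)
    (T : 𝓢'(EuclideanSpace ℝ (Fin n), ℂ)) : ℝ≥0∞ :=
  ⨆ α : Fin n → ℕ, ⨆ _ : ∑ i, α i = k, N (multiDeriv α T)

/-- The support of the Fourier transform of `T`. -/
def fourierSupport (T : 𝓢'(EuclideanSpace ℝ (Fin n), ℂ)) : Set (EuclideanSpace ℝ (Fin n)) :=
  Distribution.dsupport (𝓕 T : 𝓢'(EuclideanSpace ℝ (Fin n), ℂ))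

/-- The ball `{ξ : |ξ| ≤ ρ}`. -/
def ball (n : ℕ) (ρ : ℝ) : Set (EuclideanSpace ℝ (Fin n)) := {ξ | ‖ξ‖ ≤ ρ}

/-- The annulus `{ξ : ρ₁ ≤ |ξ| ≤ ρ₂}`. -/
def annulus (n : ℕ) (ρ₁ ρ₂ : ℝ) : Set (EuclideanSpace ℝ (Fin n)) := {ξ | ρ₁ ≤ ‖ξ‖ ∧ ‖ξ‖ ≤ ρ₂}

end Distributions

end

end LorentzBernstein

/-!
# Bernstein inequalities in Lorentz spaces

If the spectrum of `u` lies in a ball of radius `L R`, then `∂^α u` with `|α| = k` is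
`L ^ k m(D/L) u` for a fixed Schwartz multiplier `m`, namely `(2πi ξ)^α` times a cutoff
(`exists_multiDeriv_eq_multiplier`). If the spectrum lies in an annulus, then conversely
`u = ∑_{|α| = k} L ^ {-k} m_α(D/L) ∂^α u`, where `m_α(ξ)` is a cutoff times `conj((2πi ξ)^α) / ∑_β |(2πi ξ)^β|²`
(`exists_eq_sum_multiplier_multiDeriv`). Both rest on the fact that a tempered distribution vanishes
on all Schwartz functions supported off its support (`apply_eq_zero_of_disjoint_dsupport`). A
multiplier `m(D/L)` acts on functions in weak `L^p` as the convolution with the `L¹`-normalised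
dilate of a Schwartz function (`IsGivenBy.fourierMultiplierCLM`). All inequalities thus
reduce to convolution inequalities for a kernel of mass `O(1)` and height `O(L ^ n)`.

These follow from a single decomposition. With `s_j = u^*(2^{-j} t)`, almost everywhere
`|u| ≤ s_0 + h`, where `h = ∑_j s_{j+1} 1_{|u| > s_j}` has integral at most `t S(t)` for
`S(t) = ∑_j 2^{-j} u^*(2^{-j-1} t)` (`exists_le_rearrangement_add`). Convolving the bounded part in
`L^∞` and `h` in `L¹`, Chebyshev's inequality gives `(K * u)^*(t) ≤ 2 ‖K‖₁ S(t)`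
(`rearrangement_kernel_le`), while bounding `K` on `h` by its height gives
`|K * u| ≤ (‖K‖₁ + t ‖K‖_∞) S(t)` (`lintegral_kernel_mul_le`). Finally `S` has the same Lorentz
norms as `u^*` up to constants when `p > 1`, a dyadic form of Hardy's inequality valid for every second
exponent (`exists_lorentzFunctional_dyadicAverage_le`). The gain from weak `L^p` to `L^{q,1}` comes
from the sup bound for `t ≤ L ^ {-n}` and the weak `L^p` bound for `t ≥ L ^ {-n}`.
-/

namespace LorentzBernstein

/-! ### The decreasing rearrangement -/

section Rearrangement

variable {X : Type*} [MeasurableSpace X] {μ : Measure X} {f g : X → ℂ}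

lemma rearrangement_antitone (μ : Measure X) (f : X → ℂ) : Antitone (rearrangement μ f) :=
  fun _ _ h => sInf_le_sInf fun _ hs => ⟨hs.1, hs.2.trans h⟩

lemma rearrangement_congr (h : f =ᵐ[μ] g) : rearrangement μ f = rearrangement μ g := by
  have : distribFun μ f = distribFun μ g := by
    funext s
    refine measure_congr ?_
    filter_upwards [h] with x hx
    exact congrArg (fun z : ℂ => s < ‖z‖ₑ) hx
  funext t
  simp only [rearrangement, this]

lemma rearrangement_le {s t : ℝ≥0∞} (h : ∀ r, s < r → r < ∞ → distribFun μ f r ≤ t) :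
    rearrangement μ f t ≤ s := by
  refine le_of_forall_gt_imp_ge_of_dense fun r hr => ?_
  rcases eq_or_ne r ∞ with rfl | hr'
  · exact le_top
  · exact sInf_le ⟨bot_lt_of_lt hr, h r hr hr'.lt_top⟩

/-- The infimum defining the rearrangement is attained, up to the requirement `s > 0`: the
distribution function is right-continuous. -/
lemma distribFun_rearrangement_le (μ : Measure X) (f : X → ℂ) (t : ℝ≥0∞) :
    distribFun μ f (rearrangement μ f t) ≤ t := by
  obtain ⟨s, hs_anti, hs_lim, hs⟩ := exists_seq_tendsto_sInf
    (S := {s : ℝ≥0∞ | 0 < s ∧ distribFun μ f s ≤ t})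
    ⟨∞, by simp [distribFun]⟩ (OrderBot.bddBelow _)
  have hU : {x | rearrangement μ f t < ‖f x‖ₑ} ⊆ ⋃ n, {x | s n < ‖f x‖ₑ} := by
    intro x hx
    obtain ⟨n, hn⟩ := (hs_lim.eventually (gt_mem_nhds hx)).exists
    exact Set.mem_iUnion.2 ⟨n, hn⟩
  refine (measure_mono hU).trans ?_
  rw [Monotone.measure_iUnion]
  · exact iSup_le fun n => (hs n).2
  · exact fun i j hij x hx => lt_of_le_of_lt (hs_anti hij) hx

lemma rearrangement_add_le (s t : ℝ≥0∞) :
    rearrangement μ (f + g) (s + t) ≤ rearrangement μ f s + rearrangement μ g t := by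
  refine rearrangement_le fun r hr _ => ?_
  refine (measure_mono (t := {x | rearrangement μ f s < ‖f x‖ₑ} ∪
    {x | rearrangement μ g t < ‖g x‖ₑ}) fun x hx => ?_).trans
    ((measure_union_le _ _).trans (add_le_add (distribFun_rearrangement_le μ f s)
      (distribFun_rearrangement_le μ g t)))
  by_contra hcon
  simp only [Set.mem_union, Set.mem_ofPred_eq, not_or, not_lt] at hcon hx
  exact absurd (hr.trans hx) (not_lt.2 ((enorm_add_le _ _).trans (add_le_add hcon.1 hcon.2)))

/-- The dyadic substitute `∑_j 2^{-j} F(2^{-j-1} t)` for the averages `t⁻¹ ∫_0^t F` of a decreasing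
function `F`. -/
noncomputable def dyadicAverage (F : ℝ≥0∞ → ℝ≥0∞) (t : ℝ≥0∞) : ℝ≥0∞ :=
  ∑' j : ℕ, 2⁻¹ ^ j * F (t * 2⁻¹ ^ (j + 1))

lemma le_dyadicAverage {F : ℝ≥0∞ → ℝ≥0∞} (hF : Antitone F) (t : ℝ≥0∞) :
    F t ≤ dyadicAverage F t := by
  have h : F t ≤ 2⁻¹ ^ 0 * F (t * 2⁻¹ ^ (0 + 1)) := by
    rw [pow_zero, one_mul]
    exact hF (mul_le_of_le_one_right' (by simp))
  exact h.trans (ENNReal.le_tsum 0)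

/-- A function splits at height `u^*(t)` into a bounded part and a part whose integral is
controlled by the rearrangement at times below `t`. -/
lemma exists_le_rearrangement_add (μ : Measure X) (f : X → ℂ) {t : ℝ≥0∞} (ht : t ≠ ∞) :
    ∃ h : X → ℝ≥0∞, Measurable h ∧ (∀ᵐ x ∂μ, ‖f x‖ₑ ≤ rearrangement μ f t + h x) ∧
      ∫⁻ x, h x ∂μ ≤ t * dyadicAverage (rearrangement μ f) t := by
  set s : ℕ → ℝ≥0∞ := fun j => rearrangement μ f (t * 2⁻¹ ^ j) with hs
  set A : ℕ → Set X := fun j => {x | s j < ‖f x‖ₑ} with hA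
  have hμA : ∀ j, μ (A j) ≤ t * 2⁻¹ ^ j := fun j => distribFun_rearrangement_le μ f _
  -- The measurable hulls of the superlevel sets make `h` measurable whatever `f` is.
  refine ⟨fun x => ∑' j, (toMeasurable μ (A j)).indicator (fun _ => s (j + 1)) x, ?_, ?_, ?_⟩
  · exact Measurable.tsum fun j =>
      measurable_const.indicator (measurableSet_toMeasurable _ _)
  · have hnull : μ (⋂ j, A j) = 0 := by
      have hlim : Filter.Tendsto (fun j : ℕ => t * (2⁻¹ : ℝ≥0∞) ^ j) Filter.atTop (nhds 0) := by
        have := ENNReal.Tendsto.const_mul (a := t)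
          (ENNReal.tendsto_pow_atTop_nhds_zero_of_lt_one (r := 2⁻¹) (by simp))
          (Or.inr ht)
        simpa using this
      exact le_antisymm (ge_of_tendsto' hlim fun j =>
        (measure_mono (Set.iInter_subset _ j)).trans (hμA j)) bot_le
    have hae : ∀ᵐ x ∂μ, x ∉ ⋂ j, A j := measure_eq_zero_iff_ae_notMem.1 hnull
    filter_upwards [hae] with x hx
    have hex : ∃ j, ¬ s j < ‖f x‖ₑ := by simpa [hA] using hx
    classical
    -- The first index `j` with `‖f x‖ ≤ s j` gives the only term of the sum that is needed.
    have hj := Nat.find_spec hex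
    rcases hk : Nat.find hex with _ | k
    · rw [hk] at hj
      refine (not_lt.1 hj).trans ?_
      simp [hs]
    · rw [hk] at hj
      have hxk : x ∈ A k := not_not.1 (Nat.find_min hex (hk ▸ Nat.lt_succ_self k))
      refine le_add_left (le_trans ?_ (ENNReal.le_tsum k))
      rw [Set.indicator_of_mem (subset_toMeasurable _ _ hxk)]
      exact not_lt.1 hj
  · rw [lintegral_tsum fun j =>
      (measurable_const.indicator (measurableSet_toMeasurable _ _)).aemeasurable,
      dyadicAverage, ← ENNReal.tsum_mul_left]
    refine ENNReal.tsum_le_tsum fun j => ?_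
    rw [lintegral_indicator_const (measurableSet_toMeasurable _ _), measure_toMeasurable,
      mul_comm, ← mul_assoc]
    exact mul_le_mul_left (hμA j) _

end Rearrangement

/-! ### The Lorentz functional on functions of one variable -/

section Functional

/-- The Lorentz functional `(∫_0^∞ (t^{1/p} F(t))^q dt / t)^{1/q}`, with the usual change for
`q = ∞`, of a function `F` of one real variable. -/
noncomputable def lorentzFunctional (p q : ℝ≥0∞) (F : ℝ → ℝ≥0∞) : ℝ≥0∞ :=
  if q = ∞ then
    ⨆ t : ℝ, ⨆ _ : 0 < t, ENNReal.ofReal t ^ (p⁻¹).toReal * F t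
  else
    (∫⁻ t in Set.Ioi (0 : ℝ),
      (ENNReal.ofReal t ^ (p⁻¹).toReal * F t) ^ q.toReal / ENNReal.ofReal t) ^ (q.toReal)⁻¹

lemma lorentzNorm_eq {X : Type*} [MeasurableSpace X] (p q : ℝ≥0∞) (μ : Measure X) (f : X → ℂ) :
    lorentzNorm p q μ f =
      lorentzFunctional p q fun t => rearrangement μ f (ENNReal.ofReal t) := rfl

variable {p q : ℝ≥0∞} {F G : ℝ → ℝ≥0∞}

lemma lorentzFunctional_mono (h : ∀ t, 0 < t → F t ≤ G t) :
    lorentzFunctional p q F ≤ lorentzFunctional p q G := by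
  unfold lorentzFunctional
  split_ifs
  · gcongr with t ht
    exact h t ht
  · refine ENNReal.rpow_le_rpow (setLIntegral_mono' measurableSet_Ioi fun t ht => ?_)
      (by positivity)
    gcongr
    exact h t ht

lemma lorentzFunctional_const_mul (hq : q ≠ 0) {c : ℝ≥0∞} (hc : c ≠ ∞) :
    lorentzFunctional p q (fun t => c * F t) = c * lorentzFunctional p q F := by
  unfold lorentzFunctional
  split_ifs with h
  · simp only [ENNReal.mul_iSup, mul_left_comm]
  · have hq' : 0 < q.toReal := ENNReal.toReal_pos hq h
    have : ∀ t : ℝ, (ENNReal.ofReal t ^ (p⁻¹).toReal * (c * F t)) ^ q.toReal / ENNReal.ofReal t =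
        c ^ q.toReal *
          ((ENNReal.ofReal t ^ (p⁻¹).toReal * F t) ^ q.toReal / ENNReal.ofReal t) := by
      intro t
      rw [mul_left_comm, ENNReal.mul_rpow_of_nonneg _ _ hq'.le, mul_div_assoc]
    simp only [this]
    rw [lintegral_const_mul' _ _ (ENNReal.rpow_ne_top_of_nonneg hq'.le hc),
      ENNReal.mul_rpow_of_nonneg _ _ (by positivity), ← ENNReal.rpow_mul,
      mul_inv_cancel₀ hq'.ne', ENNReal.rpow_one]

/-- Dilation invariance of `dt / t` on the half-line. -/
lemma setLIntegral_Ioi_comp_mul_div (H : ℝ → ℝ≥0∞) {c : ℝ} (hc : 0 < c) :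
    ∫⁻ t in Set.Ioi (0 : ℝ), H (c * t) / ENNReal.ofReal t =
      ∫⁻ t in Set.Ioi (0 : ℝ), H t / ENNReal.ofReal t := by
  have hemb : MeasurableEmbedding fun t : ℝ => c * t :=
    (Homeomorph.mulLeft₀ c hc.ne').measurableEmbedding
  have hpre : (fun t : ℝ => c * t) ⁻¹' Set.Ioi 0 = Set.Ioi 0 := by
    ext t
    simp [hc]
  conv_rhs => rw [← Real.smul_map_volume_mul_left hc.ne']
  rw [Measure.restrict_smul, lintegral_smul_measure, hemb.restrict_map, hemb.lintegral_map, hpre,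
    smul_eq_mul, ← lintegral_const_mul' _ _ ENNReal.ofReal_ne_top]
  refine setLIntegral_congr_fun measurableSet_Ioi fun t ht => ?_
  have hc' : ENNReal.ofReal c ≠ 0 := by simpa using hc
  simp only [abs_of_pos hc, ENNReal.ofReal_mul hc.le, ENNReal.div_eq_inv_mul]
  rw [ENNReal.mul_inv (Or.inl hc') (Or.inl ENNReal.ofReal_ne_top), ← mul_assoc, ← mul_assoc,
    ENNReal.mul_inv_cancel hc' ENNReal.ofReal_ne_top, one_mul]

lemma lorentzFunctional_comp_mul (hq : q ≠ 0) {c : ℝ} (hc : 0 < c) :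
    lorentzFunctional p q (fun t => F (c * t)) =
      ENNReal.ofReal c ^ (-(p⁻¹).toReal) * lorentzFunctional p q F := by
  have hc' : ENNReal.ofReal c ≠ 0 := by simpa using hc
  have hne : ENNReal.ofReal c ^ (-(p⁻¹).toReal) ≠ ∞ := by simp [hc]
  have key : ∀ t : ℝ, 0 < t → ENNReal.ofReal t ^ (p⁻¹).toReal * F (c * t) =
      ENNReal.ofReal c ^ (-(p⁻¹).toReal) *
        (ENNReal.ofReal (c * t) ^ (p⁻¹).toReal * F (c * t)) := by
    intro t ht
    rw [← mul_assoc, ENNReal.ofReal_mul hc.le,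
      ENNReal.mul_rpow_of_nonneg _ _ ENNReal.toReal_nonneg, ← mul_assoc,
      ← ENNReal.rpow_add _ _ hc' ENNReal.ofReal_ne_top]
    simp
  unfold lorentzFunctional
  split_ifs with h
  · simp only [ENNReal.mul_iSup]
    apply le_antisymm
    · refine iSup₂_le fun t ht => ?_
      rw [key t ht]
      exact le_iSup₂_of_le (c * t) (by positivity) le_rfl
    · refine iSup₂_le fun t ht => ?_
      refine le_iSup₂_of_le (c⁻¹ * t) (by positivity) ?_
      rw [key _ (by positivity), mul_inv_cancel_left₀ hc.ne']
  · have hq' : 0 < q.toReal := ENNReal.toReal_pos hq h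
    have : ∫⁻ t in Set.Ioi (0 : ℝ),
        (ENNReal.ofReal t ^ (p⁻¹).toReal * F (c * t)) ^ q.toReal / ENNReal.ofReal t =
        ∫⁻ t in Set.Ioi (0 : ℝ), (ENNReal.ofReal c ^ (-(p⁻¹).toReal)) ^ q.toReal *
          ((fun r => (ENNReal.ofReal r ^ (p⁻¹).toReal * F r) ^ q.toReal) (c * t)
            / ENNReal.ofReal t) := by
      refine setLIntegral_congr_fun measurableSet_Ioi fun t ht => ?_
      simp only
      rw [key t ht, ENNReal.mul_rpow_of_nonneg _ _ hq'.le, mul_div_assoc]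
    rw [this, lintegral_const_mul' _ _ (ENNReal.rpow_ne_top_of_nonneg hq'.le hne),
      setLIntegral_Ioi_comp_mul_div
        (fun r => (ENNReal.ofReal r ^ (p⁻¹).toReal * F r) ^ q.toReal) hc,
      ENNReal.mul_rpow_of_nonneg _ _ (by positivity),
      ← ENNReal.rpow_mul, mul_inv_cancel₀ hq'.ne', ENNReal.rpow_one]

/-- Geometrically weighted sums are bounded for the Lorentz functional, uniformly in all
exponents, although it is only a quasi-norm. -/
lemma exists_lorentzFunctional_tsum_le (p : ℝ≥0∞) (hq : q ≠ 0) {ρ : ℝ≥0∞} (hρ : ρ < 1) :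
    ∃ C : ℝ≥0∞, C ≠ ∞ ∧ ∀ (F : ℕ → ℝ → ℝ≥0∞) (M : ℝ≥0∞), (∀ j, Measurable (F j)) →
      (∀ j, lorentzFunctional p q (F j) ≤ M) →
      lorentzFunctional p q (fun t => ∑' j, ρ ^ j * F j t) ≤ C * M := by
  by_cases h : q = ∞
  · refine ⟨(1 - ρ)⁻¹, by simpa [tsub_eq_zero_iff_le] using hρ, fun F M _ hM => ?_⟩
    simp only [lorentzFunctional, if_pos h] at hM ⊢
    refine iSup₂_le fun t ht => ?_
    rw [← ENNReal.tsum_geometric, ← ENNReal.tsum_mul_left, ← ENNReal.tsum_mul_right]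
    refine ENNReal.tsum_le_tsum fun j => ?_
    rw [mul_left_comm]
    exact mul_le_mul_right ((le_iSup₂ (f := fun t _ => _) t ht).trans (hM j)) _
  · have hq' : 0 < q.toReal := ENNReal.toReal_pos hq h
    -- Half of the geometric decay makes the sum comparable with a supremum, the other half
    -- makes the sum of the `q`-th powers converge.
    set σ : ℝ≥0∞ := ρ ^ (2⁻¹ : ℝ) with hσ
    have hσρ : σ * σ = ρ := by
      rw [hσ, ← ENNReal.rpow_add_of_nonneg _ _ (by norm_num) (by norm_num)]
      norm_num
    have hσ1 : σ < 1 := ENNReal.rpow_lt_one hρ (by norm_num)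
    have hσq1 : σ ^ q.toReal < 1 := ENNReal.rpow_lt_one hσ1 hq'
    set A : ℝ≥0∞ := (1 - σ)⁻¹
    set B : ℝ≥0∞ := (1 - σ ^ q.toReal)⁻¹
    have hA : A ≠ ∞ := by simpa [A, tsub_eq_zero_iff_le] using hσ1
    have hB : B ≠ ∞ := by simpa [B, tsub_eq_zero_iff_le] using hσq1
    refine ⟨A * B ^ (q.toReal)⁻¹,
      ENNReal.mul_ne_top hA (ENNReal.rpow_ne_top_of_nonneg (by positivity) hB),
      fun F M hF hM => ?_⟩
    have hM' : ∀ j, ∫⁻ t in Set.Ioi (0 : ℝ),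
        (ENNReal.ofReal t ^ (p⁻¹).toReal * F j t) ^ q.toReal / ENNReal.ofReal t
          ≤ M ^ q.toReal := by
      intro j
      have := hM j
      simp only [lorentzFunctional, if_neg h] at this
      rwa [ENNReal.rpow_inv_le_iff hq'] at this
    simp only [lorentzFunctional, if_neg h]
    rw [ENNReal.rpow_inv_le_iff hq', ENNReal.mul_rpow_of_nonneg _ _ hq'.le,
      ENNReal.mul_rpow_of_nonneg _ _ hq'.le, ← ENNReal.rpow_mul, inv_mul_cancel₀ hq'.ne',
      ENNReal.rpow_one]
    have hpt : ∀ t : ℝ,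
        (ENNReal.ofReal t ^ (p⁻¹).toReal * ∑' j, ρ ^ j * F j t) ^ q.toReal / ENNReal.ofReal t ≤
        A ^ q.toReal * ∑' j, (σ ^ q.toReal) ^ j *
          ((ENNReal.ofReal t ^ (p⁻¹).toReal * F j t) ^ q.toReal / ENNReal.ofReal t) := by
      intro t
      set w := ENNReal.ofReal t ^ (p⁻¹).toReal
      set T := ∑' j, (σ ^ q.toReal) ^ j * (w * F j t) ^ q.toReal with hT
      have h1 : ∀ j, σ ^ j * (w * F j t) ≤ T ^ (q.toReal)⁻¹ := by
        intro j
        rw [ENNReal.le_rpow_inv_iff hq', ENNReal.mul_rpow_of_nonneg _ _ hq'.le]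
        refine le_trans (le_of_eq ?_) (ENNReal.le_tsum j)
        rw [← ENNReal.rpow_natCast, ← ENNReal.rpow_natCast, ← ENNReal.rpow_mul,
          mul_comm (j : ℝ), ENNReal.rpow_mul]
      have h2 : w * ∑' j, ρ ^ j * F j t ≤ A * T ^ (q.toReal)⁻¹ := by
        rw [← ENNReal.tsum_mul_left, show A = ∑' j, σ ^ j from (ENNReal.tsum_geometric σ).symm,
          ← ENNReal.tsum_mul_right]
        refine ENNReal.tsum_le_tsum fun j => ?_
        calc w * (ρ ^ j * F j t) = σ ^ j * (σ ^ j * (w * F j t)) := by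
              rw [← hσρ, mul_pow]; ring
          _ ≤ _ := mul_le_mul_right (h1 j) _
      calc _ ≤ (A * T ^ (q.toReal)⁻¹) ^ q.toReal / ENNReal.ofReal t := by gcongr
        _ = _ := by
          rw [ENNReal.mul_rpow_of_nonneg _ _ hq'.le, ← ENNReal.rpow_mul,
            inv_mul_cancel₀ hq'.ne', ENNReal.rpow_one, mul_div_assoc, hT, div_eq_mul_inv,
            ← ENNReal.tsum_mul_right]
          simp only [div_eq_mul_inv, mul_assoc]
    refine (lintegral_mono hpt).trans ?_
    rw [lintegral_const_mul' _ _ (ENNReal.rpow_ne_top_of_nonneg hq'.le hA), lintegral_tsum,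
      mul_assoc]
    · refine mul_le_mul_right ?_ _
      rw [show B = ∑' j, (σ ^ q.toReal) ^ j from (ENNReal.tsum_geometric _).symm,
        ← ENNReal.tsum_mul_right]
      refine ENNReal.tsum_le_tsum fun j => ?_
      rw [lintegral_const_mul' _ _ (ENNReal.pow_ne_top hσq1.ne_top)]
      exact mul_le_mul_right (hM' j) _
    · intro j
      have := hF j
      exact Measurable.aemeasurable (by fun_prop)

/-- Hardy's inequality for the dyadic averages, for `p > 1`. -/
lemma exists_lorentzFunctional_dyadicAverage_le (hp : 1 < p) (hq : q ≠ 0) :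
    ∃ C : ℝ≥0∞, C ≠ ∞ ∧ ∀ F : ℝ≥0∞ → ℝ≥0∞, Antitone F →
      lorentzFunctional p q (fun t => dyadicAverage F (ENNReal.ofReal t)) ≤
        C * lorentzFunctional p q fun t => F (ENNReal.ofReal t) := by
  set a : ℝ := (p⁻¹).toReal with ha
  have ha1 : a < 1 := by
    have : p⁻¹ < 1 := by simpa using hp
    simpa [ha] using (ENNReal.toReal_lt_toReal this.ne_top ENNReal.one_ne_top).2 this
  have h2 : (2⁻¹ : ℝ≥0∞) ≠ 0 := by simp
  have h2' : (2⁻¹ : ℝ≥0∞) ≠ ∞ := by simp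
  obtain ⟨C, hC, H⟩ := exists_lorentzFunctional_tsum_le p hq (ρ := 2⁻¹ ^ (1 - a))
    (ENNReal.rpow_lt_one (by simp) (by linarith))
  refine ⟨C * 2⁻¹ ^ (-a), ENNReal.mul_ne_top hC (by simp), fun F hF => ?_⟩
  rw [mul_assoc]
  refine le_trans (le_of_eq ?_) (H (fun j t => (2⁻¹ ^ a) ^ j *
    F (ENNReal.ofReal (2⁻¹ ^ (j + 1) * t))) _ (fun j => ?_) (fun j => le_of_eq ?_))
  · congr 1
    funext t
    refine tsum_congr fun j => ?_
    rw [← mul_assoc, ← mul_pow, ← ENNReal.rpow_add _ _ h2 h2', sub_add_cancel, ENNReal.rpow_one,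
      ENNReal.ofReal_mul (by positivity), mul_comm (ENNReal.ofReal t),
      ENNReal.ofReal_pow (by positivity), ENNReal.ofReal_inv_of_pos two_pos, ENNReal.ofReal_ofNat]
  · exact measurable_const.mul (hF.measurable.comp (by fun_prop))
  · rw [lorentzFunctional_const_mul hq (by simp), lorentzFunctional_comp_mul (c := 2⁻¹ ^ (j + 1))
        (F := fun t => F (ENNReal.ofReal t)) hq (by positivity), ← mul_assoc]
    congr 1
    rw [ENNReal.ofReal_pow (by positivity), ENNReal.ofReal_inv_of_pos two_pos,
      ENNReal.ofReal_ofNat, ← ENNReal.rpow_natCast, ← ENNReal.rpow_natCast, ← ENNReal.rpow_mul,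
      ← ENNReal.rpow_mul, ← ENNReal.rpow_add _ _ h2 h2', ← ha]
    congr 1
    push_cast
    ring

/-- For decreasing functions, `L^{p,q}` embeds into `L^{p,∞}`. -/
lemma exists_lorentzFunctional_top_le (p : ℝ≥0∞) (hq : q ≠ 0) :
    ∃ C : ℝ≥0∞, C ≠ ∞ ∧ ∀ F : ℝ → ℝ≥0∞, Antitone F →
      lorentzFunctional p ∞ F ≤ C * lorentzFunctional p q F := by
  by_cases h : q = ∞
  · exact ⟨1, ENNReal.one_ne_top, fun F _ => by rw [h, one_mul]⟩
  have hq' : 0 < q.toReal := ENNReal.toReal_pos hq h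
  set a : ℝ := (p⁻¹).toReal with ha
  refine ⟨2 ^ a * 2 ^ (q.toReal)⁻¹, ENNReal.mul_ne_top (by simp [ha]) (by simp), fun F hF => ?_⟩
  simp only [lorentzFunctional, if_neg h]
  refine iSup₂_le fun t ht => ?_
  set t' := ENNReal.ofReal t
  have ht' : t' ≠ 0 := by simpa [t'] using ht
  -- The integral over `(t/2, t)` alone controls the value at `t`.
  have key : 2⁻¹ * ((t' / 2) ^ a * F t) ^ q.toReal ≤ ∫⁻ t in Set.Ioi (0 : ℝ),
      (ENNReal.ofReal t ^ a * F t) ^ q.toReal / ENNReal.ofReal t := by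
    calc 2⁻¹ * ((t' / 2) ^ a * F t) ^ q.toReal
        = ∫⁻ _ in Set.Ioo (t / 2) t, ((t' / 2) ^ a * F t) ^ q.toReal / t' := by
          rw [setLIntegral_const, Real.volume_Ioo, show t - t / 2 = t / 2 by ring,
            ENNReal.ofReal_div_of_pos two_pos, ENNReal.ofReal_ofNat, div_eq_mul_inv,
            div_eq_mul_inv, mul_comm, mul_assoc]
          congr 1
          rw [← mul_assoc, ENNReal.inv_mul_cancel ht' ENNReal.ofReal_ne_top, one_mul]
      _ ≤ ∫⁻ r in Set.Ioo (t / 2) t, (ENNReal.ofReal r ^ a * F r) ^ q.toReal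
            / ENNReal.ofReal r := by
          refine setLIntegral_mono' measurableSet_Ioo fun r hr => ?_
          have h1 : t' / 2 ≤ ENNReal.ofReal r := by
            rw [show t' / 2 = ENNReal.ofReal (t / 2) by
              rw [ENNReal.ofReal_div_of_pos two_pos, ENNReal.ofReal_ofNat]]
            exact ENNReal.ofReal_le_ofReal hr.1.le
          have h2 : ENNReal.ofReal r ≤ t' := ENNReal.ofReal_le_ofReal hr.2.le
          have h3 : F t ≤ F r := hF hr.2.le
          have ha0 : 0 ≤ a := ENNReal.toReal_nonneg
          gcongr
      _ ≤ _ := lintegral_mono_set fun r hr => lt_trans (by simpa using ht) hr.1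
  have h2 : (2 : ℝ≥0∞) ^ (q.toReal)⁻¹ * (2⁻¹) ^ (q.toReal)⁻¹ = 1 := by
    rw [← ENNReal.mul_rpow_of_nonneg _ _ (by positivity),
      ENNReal.mul_inv_cancel two_ne_zero ENNReal.ofNat_ne_top, ENNReal.one_rpow]
  have h3 : (2 : ℝ≥0∞) ^ a * (t' / 2) ^ a = t' ^ a := by
    rw [← ENNReal.mul_rpow_of_nonneg _ _ ENNReal.toReal_nonneg,
      ENNReal.mul_div_cancel two_ne_zero ENNReal.ofNat_ne_top]
  calc t' ^ a * F t
      = 2 ^ a * 2 ^ (q.toReal)⁻¹ * (2⁻¹ * ((t' / 2) ^ a * F t) ^ q.toReal) ^ (q.toReal)⁻¹ := by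
        rw [ENNReal.mul_rpow_of_nonneg _ _ (by positivity), ← ENNReal.rpow_mul,
          mul_inv_cancel₀ hq'.ne', ENNReal.rpow_one, ← h3]
        calc _ = 2 ^ a * (2 ^ (q.toReal)⁻¹ * 2⁻¹ ^ (q.toReal)⁻¹) * ((t' / 2) ^ a * F t) := by
              rw [h2]; ring
          _ = _ := by ring
    _ ≤ _ := by gcongr

end Functional

/-! ### Lorentz quasi-norms -/

section Norm

variable {X : Type*} [MeasurableSpace X] {μ : Measure X} {f g : X → ℂ} {p q : ℝ≥0∞}

lemma lorentzNorm_congr (h : f =ᵐ[μ] g) : lorentzNorm p q μ f = lorentzNorm p q μ g := by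
  rw [lorentzNorm_eq, lorentzNorm_eq, rearrangement_congr h]

lemma antitone_rearrangement_ofReal (μ : Measure X) (f : X → ℂ) :
    Antitone fun t : ℝ => rearrangement μ f (ENNReal.ofReal t) :=
  fun _ _ h => rearrangement_antitone μ f (ENNReal.ofReal_le_ofReal h)

lemma MemLorentz.weak (hq : q ≠ 0) (h : MemLorentz p q μ f) : MemLorentz p ∞ μ f := by
  obtain ⟨C, hC, H⟩ := exists_lorentzFunctional_top_le p hq
  refine ⟨h.1, ?_⟩
  exact (H _ (antitone_rearrangement_ofReal μ f)).trans_lt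
    (ENNReal.mul_lt_top hC.lt_top h.2)

lemma exists_lorentzNorm_add_le (μ : Measure X) (p : ℝ≥0∞) (hq : q ≠ 0) :
    ∃ C : ℝ≥0∞, C ≠ ∞ ∧ ∀ f g : X → ℂ,
      lorentzNorm p q μ (f + g) ≤ C * (lorentzNorm p q μ f + lorentzNorm p q μ g) := by
  obtain ⟨C, hC, H⟩ := exists_lorentzFunctional_tsum_le p hq (ρ := 2⁻¹) (by simp)
  set D : ℝ≥0∞ := ENNReal.ofReal 2⁻¹ ^ (-(p⁻¹).toReal) with hD
  refine ⟨C * (2 * D), ENNReal.mul_ne_top hC (ENNReal.mul_ne_top (by simp) (by simp [hD])),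
    fun f g => ?_⟩
  set Φ : (X → ℂ) → ℝ → ℝ≥0∞ := fun f t => rearrangement μ f (ENNReal.ofReal (2⁻¹ * t)) with hΦ
  have hΦm : ∀ f, Measurable (Φ f) := fun f =>
    (antitone_rearrangement_ofReal μ f).measurable.comp (by fun_prop)
  have hΦn : ∀ f, lorentzFunctional p q (Φ f) = D * lorentzNorm p q μ f := fun f =>
    lorentzFunctional_comp_mul (F := fun t => rearrangement μ f (ENNReal.ofReal t)) hq
      (by norm_num)
  set F : ℕ → ℝ → ℝ≥0∞ := fun j => if j = 0 then Φ f else if j = 1 then fun t => 2 * Φ g t else 0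
  have h0 : lorentzFunctional p q 0 = 0 := by
    have := lorentzFunctional_const_mul (p := p) (F := 0) hq ENNReal.zero_ne_top
    simpa [Pi.zero_def] using this
  rw [mul_assoc]
  refine le_trans (lorentzFunctional_mono fun t ht => ?_) (H F _ (fun j => ?_) fun j => ?_)
  · calc rearrangement μ (f + g) (ENNReal.ofReal t)
        = rearrangement μ (f + g) (ENNReal.ofReal (2⁻¹ * t) + ENNReal.ofReal (2⁻¹ * t)) := by
          rw [← ENNReal.ofReal_add (by positivity) (by positivity)]
          congr 2
          ring
      _ ≤ Φ f t + Φ g t := rearrangement_add_le _ _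
      _ = ∑ j ∈ Finset.range 2, 2⁻¹ ^ j * F j t := by
          simp [Finset.sum_range_succ, F, ← mul_assoc,
            ENNReal.inv_mul_cancel two_ne_zero ENNReal.ofNat_ne_top]
      _ ≤ _ := ENNReal.sum_le_tsum _
  · simp only [F]
    split_ifs
    · exact hΦm f
    · exact (hΦm g).const_mul 2
    · exact measurable_const
  · simp only [F]
    split_ifs
    · rw [hΦn, mul_assoc, mul_add, mul_add]
      refine le_trans ?_ (le_add_right le_rfl)
      exact le_mul_of_one_le_left' (by norm_num)
    · rw [lorentzFunctional_const_mul hq (by simp), hΦn, mul_assoc, mul_add, mul_add]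
      exact le_add_left le_rfl
    · rw [h0]
      exact bot_le

/-- On weak `L^p` with `p > 1` the dyadic averages obey the same power bound as the
rearrangement. This is Hardy's inequality at the endpoint `q = ∞`. -/
lemma exists_dyadicAverage_le_weak (μ : Measure X) (hp : 1 < p) :
    ∃ C : ℝ≥0∞, C ≠ ∞ ∧ ∀ (u : X → ℂ) (t : ℝ), 0 < t →
      dyadicAverage (rearrangement μ u) (ENNReal.ofReal t) ≤
        C * ENNReal.ofReal t ^ (-(p⁻¹).toReal) * lorentzNorm p ∞ μ u := by
  obtain ⟨C, hC, H⟩ := exists_lorentzFunctional_dyadicAverage_le hp ENNReal.top_ne_zero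
  refine ⟨C, hC, fun u t ht => ?_⟩
  have ht' : ENNReal.ofReal t ≠ 0 := by simpa using ht
  have h := H _ (rearrangement_antitone μ u)
  have h1 : ENNReal.ofReal t ^ (p⁻¹).toReal *
      dyadicAverage (rearrangement μ u) (ENNReal.ofReal t) ≤ C * lorentzNorm p ∞ μ u := by
    refine le_trans ?_ h
    rw [lorentzFunctional, if_pos rfl]
    exact le_iSup₂ (f := fun t (_ : 0 < t) =>
      ENNReal.ofReal t ^ (p⁻¹).toReal *
        dyadicAverage (rearrangement μ u) (ENNReal.ofReal t)) t ht
  calc dyadicAverage (rearrangement μ u) (ENNReal.ofReal t)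
      = ENNReal.ofReal t ^ (-(p⁻¹).toReal) * (ENNReal.ofReal t ^ (p⁻¹).toReal *
          dyadicAverage (rearrangement μ u) (ENNReal.ofReal t)) := by
        rw [← mul_assoc, ← ENNReal.rpow_add _ _ ht' ENNReal.ofReal_ne_top]
        simp
    _ ≤ ENNReal.ofReal t ^ (-(p⁻¹).toReal) * (C * lorentzNorm p ∞ μ u) := mul_le_mul_right h1 _
    _ = _ := by ring

end Norm

/-! ### Convolution with an integrable bounded kernel -/

section Kernel

variable {G : Type*} [AddCommGroup G] [MeasurableSpace G] [MeasurableAdd₂ G] [MeasurableNeg G]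
  {μ : Measure G} [μ.IsAddLeftInvariant] {K : G → ℝ≥0∞} {u v : G → ℂ} {p q : ℝ≥0∞}

lemma lintegral_kernel_le (hK : Measurable K) {h : G → ℝ≥0∞} {a : ℝ≥0∞}
    (hu : ∀ᵐ y ∂μ, ‖u y‖ₑ ≤ a + h y) (x : G) :
    ∫⁻ y, K (y - x) * ‖u y‖ₑ ∂μ ≤ (∫⁻ x, K x ∂μ) * a + ∫⁻ y, K (y - x) * h y ∂μ := by
  calc ∫⁻ y, K (y - x) * ‖u y‖ₑ ∂μ ≤ ∫⁻ y, (K (y - x) * a + K (y - x) * h y) ∂μ := by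
        refine lintegral_mono_ae ?_
        filter_upwards [hu] with y hy
        rw [← mul_add]
        exact mul_le_mul_right hy _
    _ = _ := by
        rw [lintegral_add_left (by fun_prop), lintegral_mul_const _ (by fun_prop)]
        congr 2
        simp only [sub_eq_add_neg]
        have hr : μ.IsAddRightInvariant := inferInstance
        exact lintegral_add_right_eq_self K (-x)

/-- Hölder's inequality in Lorentz form: an integrable bounded kernel acts on any function with
finite dyadic averages. -/
lemma lintegral_kernel_mul_le (hK : Measurable K) {B : ℝ≥0∞} (hB : ∀ x, K x ≤ B) (u : G → ℂ)
    {t : ℝ≥0∞} (ht : t ≠ ∞) (x : G) :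
    ∫⁻ y, K (y - x) * ‖u y‖ₑ ∂μ ≤
      (∫⁻ x, K x ∂μ + B * t) * dyadicAverage (rearrangement μ u) t := by
  obtain ⟨h, hh, hu, hint⟩ := exists_le_rearrangement_add μ u ht
  refine (lintegral_kernel_le hK hu x).trans ?_
  rw [add_mul]
  gcongr
  · exact le_dyadicAverage (rearrangement_antitone μ u) t
  · calc ∫⁻ y, K (y - x) * h y ∂μ ≤ ∫⁻ y, B * h y ∂μ := by
          gcongr with y
          exact hB _
      _ = B * ∫⁻ y, h y ∂μ := lintegral_const_mul _ hh
      _ ≤ _ := by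
          rw [mul_assoc]
          exact mul_le_mul_right hint _

/-- A kernel of mass at most `A` and height at most `A / τ` maps weak `L^p` to `L^∞`. -/
lemma exists_lintegral_kernel_le_weak (hp : 1 < p) :
    ∃ C : ℝ≥0∞, C ≠ ∞ ∧ ∀ (K : G → ℝ≥0∞) (u : G → ℂ) (A : ℝ≥0∞) (τ : ℝ), Measurable K → 0 < τ →
      ∫⁻ x, K x ∂μ ≤ A → (∀ x, K x ≤ A / ENNReal.ofReal τ) → ∀ x,
      ∫⁻ y, K (y - x) * ‖u y‖ₑ ∂μ ≤
        C * A * ENNReal.ofReal τ ^ (-(p⁻¹).toReal) * lorentzNorm p ∞ μ u := by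
  obtain ⟨C, hC, H⟩ := exists_dyadicAverage_le_weak μ hp
  refine ⟨2 * C, ENNReal.mul_ne_top (by simp) hC, fun K u A τ hK hτ hA hB x => ?_⟩
  have hτ' : ENNReal.ofReal τ ≠ 0 := by simpa using hτ
  refine (lintegral_kernel_mul_le hK hB u (ENNReal.ofReal_ne_top (r := τ)) x).trans ?_
  rw [ENNReal.div_mul_cancel hτ' ENNReal.ofReal_ne_top]
  calc _ ≤ (A + A) * (C * ENNReal.ofReal τ ^ (-(p⁻¹).toReal) * lorentzNorm p ∞ μ u) := by
        gcongr
        exact H u τ hτ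
    _ = _ := by ring

variable [SFinite μ] [μ.IsNegInvariant]

lemma lintegral_kernel_swap (hK : Measurable K) {h : G → ℝ≥0∞} (hh : Measurable h) :
    ∫⁻ x, ∫⁻ y, K (y - x) * h y ∂μ ∂μ = (∫⁻ x, K x ∂μ) * ∫⁻ y, h y ∂μ := by
  rw [lintegral_lintegral_swap (by fun_prop)]
  have : ∀ y, ∫⁻ x, K (y - x) * h y ∂μ = (∫⁻ x, K x ∂μ) * h y := by
    intro y
    rw [lintegral_mul_const _ (by fun_prop), lintegral_sub_left_eq_self]
  simp only [this]
  rw [lintegral_const_mul _ hh]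

/-- O'Neil's inequality for an integrable kernel: the part of `u` above height `u^*(t)` is
convolved in `L¹` and handled by Chebyshev's inequality, the part below in `L^∞`. -/
lemma rearrangement_kernel_le (hK : Measurable K)
    (hv : ∀ x, ‖v x‖ₑ ≤ ∫⁻ y, K (y - x) * ‖u y‖ₑ ∂μ) {t : ℝ≥0∞} (ht : t ≠ ∞) :
    rearrangement μ v t ≤ 2 * (∫⁻ x, K x ∂μ) * dyadicAverage (rearrangement μ u) t := by
  obtain ⟨h, hh, hu, hint⟩ := exists_le_rearrangement_add μ u ht
  set S := dyadicAverage (rearrangement μ u) t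
  set A := ∫⁻ x, K x ∂μ
  refine rearrangement_le fun r hr hr' => ?_
  have hAS : 2 * A * S = A * S + A * S := by ring
  have hASr : A * S < r := lt_of_le_of_lt (by rw [hAS]; exact le_add_self) hr
  set ε := r - A * S with hε
  have hε1 : A * S ≤ ε := by
    rw [hAS] at hr
    exact ENNReal.le_sub_of_add_le_left hASr.ne_top hr.le
  have hε0 : ε ≠ 0 := (tsub_pos_of_lt hASr).ne'
  have hεt : ε ≠ ∞ := ENNReal.sub_ne_top hr'.ne
  set w : G → ℝ≥0∞ := fun x => ∫⁻ y, K (y - x) * h y ∂μ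
  have hw : Measurable w := by
    have : Measurable (Function.uncurry fun x y => K (y - x) * h y) := by fun_prop
    exact this.lintegral_prod_right
  have hsub : {x | r < ‖v x‖ₑ} ⊆ {x | ε ≤ w x} := by
    intro x hx
    have h1 : r ≤ A * S + w x :=
      (le_of_lt hx).trans ((hv x).trans ((lintegral_kernel_le hK hu x).trans
        (by gcongr; exact le_dyadicAverage (rearrangement_antitone μ u) t)))
    exact tsub_le_iff_left.2 h1
  have hcheb : ε * μ {x | ε ≤ w x} ≤ ε * t :=
    calc ε * μ {x | ε ≤ w x} ≤ ∫⁻ x, w x ∂μ := mul_meas_ge_le_lintegral hw ε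
      _ = A * ∫⁻ y, h y ∂μ := lintegral_kernel_swap hK hh
      _ ≤ A * (t * S) := mul_le_mul_right hint _
      _ = A * S * t := by ring
      _ ≤ ε * t := mul_le_mul_left hε1 _
  exact (measure_mono hsub).trans ((ENNReal.mul_le_mul_iff_right hε0 hεt).1 hcheb)

/-- Young's inequality on Lorentz spaces. -/
lemma exists_lorentzNorm_kernel_le (hp : 1 < p) (hq : q ≠ 0) :
    ∃ C : ℝ≥0∞, C ≠ ∞ ∧ ∀ (K : G → ℝ≥0∞) (u v : G → ℂ), Measurable K → ∫⁻ x, K x ∂μ ≠ ∞ →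
      (∀ x, ‖v x‖ₑ ≤ ∫⁻ y, K (y - x) * ‖u y‖ₑ ∂μ) →
      lorentzNorm p q μ v ≤ C * (∫⁻ x, K x ∂μ) * lorentzNorm p q μ u := by
  obtain ⟨C, hC, H⟩ := exists_lorentzFunctional_dyadicAverage_le hp hq
  refine ⟨2 * C, ENNReal.mul_ne_top (by simp) hC, fun K u v hK hA hv => ?_⟩
  calc lorentzNorm p q μ v
      ≤ lorentzFunctional p q fun t => 2 * (∫⁻ x, K x ∂μ) *
          dyadicAverage (rearrangement μ u) (ENNReal.ofReal t) :=
        lorentzFunctional_mono fun t _ => rearrangement_kernel_le hK hv ENNReal.ofReal_ne_top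
    _ = 2 * (∫⁻ x, K x ∂μ) * lorentzFunctional p q fun t =>
          dyadicAverage (rearrangement μ u) (ENNReal.ofReal t) :=
        lorentzFunctional_const_mul hq (ENNReal.mul_ne_top (by simp) hA)
    _ ≤ 2 * (∫⁻ x, K x ∂μ) * (C * lorentzNorm p q μ u) :=
        mul_le_mul_right (H _ (rearrangement_antitone μ u)) _
    _ = _ := by ring

lemma lorentzFunctional_min_rpow_ne_top (hpq : p < q) (hq : q ≠ ∞) (hp : p ≠ 0) :
    lorentzFunctional q 1 (fun t => min 1 (ENNReal.ofReal t ^ (-(p⁻¹).toReal))) ≠ ∞ := by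
  set a := (p⁻¹).toReal with ha
  set b := (q⁻¹).toReal with hb
  have hq0 : q ≠ 0 := (bot_lt_of_lt hpq).ne'
  have hb0 : 0 < b := ENNReal.toReal_pos (by simpa using hq) (by simpa using hq0)
  have hab : b < a := (ENNReal.toReal_lt_toReal (by simpa using hq0) (by simpa using hp)).2
    (ENNReal.inv_lt_inv.2 hpq)
  rw [lorentzFunctional, if_neg ENNReal.one_ne_top]
  simp only [ENNReal.toReal_one, ENNReal.rpow_one, inv_one]
  rw [← Set.Ioc_union_Ioi_eq_Ioi zero_le_one]
  refine ((lintegral_union_le _ _ _).trans_lt (ENNReal.add_lt_top.2 ⟨?_, ?_⟩)).ne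
  · have hint : IntegrableOn (fun t : ℝ => t ^ (b - 1)) (Set.Ioc 0 1) :=
      (intervalIntegral.intervalIntegrable_rpow' (a := 0) (b := 1) (r := b - 1) (by linarith)).1
    refine lt_of_le_of_lt (setLIntegral_mono' measurableSet_Ioc fun t ht => ?_)
      hint.setLIntegral_lt_top
    have ht' : ENNReal.ofReal t ≠ 0 := by simpa using ht.1
    rw [← ENNReal.ofReal_rpow_of_pos ht.1, ENNReal.rpow_sub _ _ ht' ENNReal.ofReal_ne_top,
      ENNReal.rpow_one]
    gcongr
    exact mul_le_of_le_one_right' (min_le_left _ _)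
  · have hint : IntegrableOn (fun t : ℝ => t ^ (b - a - 1)) (Set.Ioi 1) :=
      integrableOn_Ioi_rpow_of_lt (by linarith) one_pos
    refine lt_of_le_of_lt (setLIntegral_mono' measurableSet_Ioi fun t ht => ?_)
      hint.setLIntegral_lt_top
    have ht0 : 0 < t := one_pos.trans ht
    have ht' : ENNReal.ofReal t ≠ 0 := by simpa using ht0
    rw [← ENNReal.ofReal_rpow_of_pos ht0, ENNReal.rpow_sub _ _ ht' ENNReal.ofReal_ne_top,
      ENNReal.rpow_one, sub_eq_add_neg, ENNReal.rpow_add _ _ ht' ENNReal.ofReal_ne_top]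
    gcongr
    exact min_le_right _ _

/-- A kernel of mass at most `A` and height at most `A / τ` maps weak `L^p` to `L^{q,1}` for
`p < q`: the image is bounded, which is used for `t ≤ τ`, and lies in weak `L^p`, which is used
for `t ≥ τ`. -/
lemma exists_lorentzNorm_kernel_le_weak (hp : 1 < p) (hpq : p < q) (hq : q ≠ ∞) :
    ∃ C : ℝ≥0∞, C ≠ ∞ ∧ ∀ (K : G → ℝ≥0∞) (u v : G → ℂ) (A : ℝ≥0∞) (τ : ℝ), Measurable K →
      0 < τ → ∫⁻ x, K x ∂μ ≤ A → A ≠ ∞ → (∀ x, K x ≤ A / ENNReal.ofReal τ) →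
      lorentzNorm p ∞ μ u ≠ ∞ → (∀ x, ‖v x‖ₑ ≤ ∫⁻ y, K (y - x) * ‖u y‖ₑ ∂μ) →
      lorentzNorm q 1 μ v ≤
        C * A * ENNReal.ofReal τ ^ ((q⁻¹).toReal - (p⁻¹).toReal) * lorentzNorm p ∞ μ u := by
  obtain ⟨C₁, hC₁, H₁⟩ := exists_dyadicAverage_le_weak μ hp
  obtain ⟨C₂, hC₂, H₂⟩ := exists_lintegral_kernel_le_weak (G := G) (μ := μ) hp
  set a := (p⁻¹).toReal with ha
  set Ψ : ℝ → ℝ≥0∞ := fun t => min 1 (ENNReal.ofReal t ^ (-a)) with hΨ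
  have hΨt := lorentzFunctional_min_rpow_ne_top hpq hq (one_pos.trans hp).ne'
  refine ⟨(2 * C₁ + C₂) * lorentzFunctional q 1 Ψ,
    ENNReal.mul_ne_top (ENNReal.add_ne_top.2 ⟨ENNReal.mul_ne_top (by simp) hC₁, hC₂⟩) hΨt,
    fun K u v A τ hK hτ hA hAt hB hu hv => ?_⟩
  have hτ' : ENNReal.ofReal τ ≠ 0 := by simpa using hτ
  set N := lorentzNorm p ∞ μ u
  set D := (2 * C₁ + C₂) * A * ENNReal.ofReal τ ^ (-a) * N with hD
  have hDt : D ≠ ∞ := by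
    refine ENNReal.mul_ne_top (ENNReal.mul_ne_top (ENNReal.mul_ne_top
      (ENNReal.add_ne_top.2 ⟨ENNReal.mul_ne_top (by simp) hC₁, hC₂⟩) hAt) ?_) hu
    simp [hτ]
  have hpt : ∀ t : ℝ, 0 < t → rearrangement μ v (ENNReal.ofReal t) ≤ D * Ψ (τ⁻¹ * t) := by
    intro t ht
    have hsplit : D * Ψ (τ⁻¹ * t) = min D (D * ENNReal.ofReal (τ⁻¹ * t) ^ (-a)) := by
      rw [hΨ]
      simp only
      rcases min_choice 1 (ENNReal.ofReal (τ⁻¹ * t) ^ (-a)) with h | h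
      · rw [h, mul_one, min_eq_left]
        exact le_mul_of_one_le_right' (min_eq_left_iff.1 h)
      · rw [h, min_eq_right]
        exact mul_le_of_le_one_right' (min_eq_right_iff.1 h)
    rw [hsplit, le_min_iff]
    constructor
    · refine rearrangement_le fun r hr _ => ?_
      have : {x | r < ‖v x‖ₑ} = ∅ := by
        ext x
        simp only [Set.mem_ofPred_eq, Set.mem_empty_iff_false, iff_false, not_lt]
        refine ((hv x).trans (H₂ K u A τ hK hτ hA hB x)).trans (le_trans ?_ hr.le)
        rw [hD]
        gcongr
        exact le_add_self
      rw [distribFun, this, measure_empty]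
      exact bot_le
    · refine (rearrangement_kernel_le hK hv ENNReal.ofReal_ne_top).trans ?_
      have hmul : ENNReal.ofReal τ ^ (-a) * ENNReal.ofReal (τ⁻¹ * t) ^ (-a) =
          ENNReal.ofReal t ^ (-a) := by
        have h1 : τ⁻¹ * t = t / τ := by ring
        rw [ENNReal.rpow_neg, ENNReal.rpow_neg, ENNReal.rpow_neg, ← ENNReal.mul_inv,
          ← ENNReal.mul_rpow_of_nonneg _ _ ENNReal.toReal_nonneg, h1,
          ENNReal.ofReal_div_of_pos hτ, ENNReal.mul_div_cancel hτ' ENNReal.ofReal_ne_top]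
        · left
          simp [ha, hτ]
        · right
          simp [ha, hτ, ht]
      calc _ ≤ 2 * A * (C₁ * ENNReal.ofReal t ^ (-a) * N) := by
            gcongr
            exact H₁ u t ht
        _ = 2 * C₁ * A * ENNReal.ofReal t ^ (-a) * N := by ring
        _ ≤ (2 * C₁ + C₂) * A * ENNReal.ofReal t ^ (-a) * N := by
            gcongr
            exact le_self_add
        _ = D * ENNReal.ofReal (τ⁻¹ * t) ^ (-a) := by
            rw [← hmul, hD]
            ring
  calc lorentzNorm q 1 μ v ≤ lorentzFunctional q 1 fun t => D * Ψ (τ⁻¹ * t) :=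
        lorentzFunctional_mono hpt
    _ = D * (ENNReal.ofReal τ⁻¹ ^ (-(q⁻¹).toReal) * lorentzFunctional q 1 Ψ) := by
        rw [lorentzFunctional_const_mul one_ne_zero hDt,
          lorentzFunctional_comp_mul one_ne_zero (inv_pos.2 hτ)]
    _ = _ := by
        rw [ENNReal.ofReal_inv_of_pos hτ, ENNReal.inv_rpow, ENNReal.rpow_neg, inv_inv,
          sub_eq_add_neg, ENNReal.rpow_add _ _ hτ' ENNReal.ofReal_ne_top, hD]
        ring

end Kernel

/-! ### Functions as tempered distributions -/

section Given

variable {n : ℕ} {T T' : 𝓢'(EuclideanSpace ℝ (Fin n), ℂ)}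
  {f g u : EuclideanSpace ℝ (Fin n) → ℂ} {p q : ℝ≥0∞}

local notation "𝔼" => EuclideanSpace ℝ (Fin n)

lemma IsGivenBy.locallyIntegrable (h : IsGivenBy T f) : LocallyIntegrable f volume := by
  intro x
  let b : ContDiffBump x := ⟨1, 2, one_pos, one_lt_two⟩
  have hb₁ : HasCompactSupport (Complex.ofRealCLM ∘ b) := b.hasCompactSupport.comp_left rfl
  have hb₂ : ContDiff ℝ ((⊤ : ℕ∞) : WithTop ℕ∞) (Complex.ofRealCLM ∘ b) :=
    Complex.ofRealCLM.contDiff.comp b.contDiff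
  refine ⟨Metric.closedBall x 1, Metric.closedBall_mem_nhds x one_pos, ?_⟩
  refine ((h (hb₁.toSchwartzMap hb₂)).1.integrableOn (s := Metric.closedBall x 1)).congr_fun
    (fun y hy => ?_) measurableSet_closedBall
  have : b y = 1 := b.one_of_mem_closedBall hy
  simp [this]

/-- The function representing a distribution is unique almost everywhere. -/
lemma IsGivenBy.ae_eq (hf : IsGivenBy T f) (hg : IsGivenBy T g) : f =ᵐ[volume] g := by
  refine ae_eq_of_integral_contDiff_smul_eq hf.locallyIntegrable hg.locallyIntegrable
    fun φ hφ hφc => ?_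
  have h₁ : HasCompactSupport (Complex.ofRealCLM ∘ φ) := hφc.comp_left rfl
  have h₂ : ContDiff ℝ ((⊤ : ℕ∞) : WithTop ℕ∞) (Complex.ofRealCLM ∘ φ) :=
    Complex.ofRealCLM.contDiff.comp hφ
  have := (hf (h₁.toSchwartzMap h₂)).2.symm.trans (hg (h₁.toSchwartzMap h₂)).2
  simpa using this

lemma IsGivenBy.add (h : IsGivenBy T f) (h' : IsGivenBy T' g) : IsGivenBy (T + T') (f + g) := by
  intro φ
  have : (fun x => φ x * (f + g) x) = fun x => φ x * f x + φ x * g x := by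
    funext x
    simp [mul_add]
  rw [this]
  refine ⟨(h φ).1.add (h' φ).1, ?_⟩
  rw [integral_add (h φ).1 (h' φ).1, ← (h φ).2, ← (h' φ).2]
  rfl

lemma distLorentz_eq (h : IsGivenBy T f) : distLorentz p q T = lorentzNorm p q volume f := by
  refine le_antisymm (iInf₂_le f h) (le_iInf₂ fun g hg => ?_)
  rw [lorentzNorm_congr (h.ae_eq hg)]

lemma exists_isGivenBy_of_distLorentz_ne_top (h : distLorentz p q T ≠ ∞) :
    ∃ f, IsGivenBy T f := by
  by_contra hcon
  push Not at hcon
  exact h (by simp [distLorentz, distNorm, hcon])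

variable (n) in
lemma exists_distLorentz_add_le (p : ℝ≥0∞) (hq : q ≠ 0) :
    ∃ C : ℝ≥0∞, C ≠ ∞ ∧ ∀ T T' : 𝓢'(𝔼, ℂ),
      distLorentz p q (T + T') ≤ C * (distLorentz p q T + distLorentz p q T') := by
  obtain ⟨C, hC, H⟩ := exists_lorentzNorm_add_le (volume : Measure 𝔼) p hq
  -- Enlarging the constant to at least `1` makes it nonzero, so that `C * ∞ = ∞`.
  refine ⟨C + 1, by simpa using hC, fun T T' => ?_⟩
  by_cases hT : distLorentz p q T = ∞
  · rw [hT, top_add, ENNReal.mul_top (by simp)]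
    exact le_top
  by_cases hT' : distLorentz p q T' = ∞
  · rw [hT', add_top, ENNReal.mul_top (by simp)]
    exact le_top
  obtain ⟨f, hf⟩ := exists_isGivenBy_of_distLorentz_ne_top hT
  obtain ⟨g, hg⟩ := exists_isGivenBy_of_distLorentz_ne_top hT'
  rw [distLorentz_eq hf, distLorentz_eq hg, distLorentz_eq (hf.add hg)]
  exact (H f g).trans (mul_le_mul_left le_self_add _)

variable (n) in
lemma exists_distLorentz_sum_le {ι : Type*} (p : ℝ≥0∞) (hq : q ≠ 0) (s : Finset ι) :
    ∃ C : ℝ≥0∞, C ≠ ∞ ∧ ∀ T : ι → 𝓢'(𝔼, ℂ),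
      distLorentz p q (∑ i ∈ s, T i) ≤ C * ∑ i ∈ s, distLorentz p q (T i) := by
  classical
  obtain ⟨C, hC, H⟩ := exists_distLorentz_add_le n p hq
  induction s using Finset.induction_on with
  | empty =>
    refine ⟨1, ENNReal.one_ne_top, fun T => ?_⟩
    have h0 : IsGivenBy (0 : 𝓢'(𝔼, ℂ)) 0 := fun φ => by simp
    have hr : ∀ t, rearrangement (volume : Measure 𝔼) 0 t = 0 := fun t =>
      le_antisymm (rearrangement_le fun r _ _ => by simp [distribFun]) bot_le
    have h1 : lorentzNorm p q (volume : Measure 𝔼) 0 = 0 := by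
      have := lorentzFunctional_const_mul (p := p) (F := 0) hq ENNReal.zero_ne_top
      simpa [lorentzNorm_eq, hr] using this
    simp [distLorentz_eq h0, h1]
  | insert a s ha ih =>
    obtain ⟨D, hD, ih⟩ := ih
    refine ⟨C * (D + 1), ENNReal.mul_ne_top hC (by simpa using hD), fun T => ?_⟩
    rw [Finset.sum_insert ha, Finset.sum_insert ha]
    refine (H _ _).trans ?_
    rw [mul_assoc, mul_add (D + 1)]
    gcongr
    · exact le_mul_of_one_le_left' le_add_self
    · exact (ih T).trans (mul_le_mul_left le_self_add _)

/-- Every function in `L^{p,q}` with `p > 1` is a tempered distribution. -/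
lemma MemLorentz.exists_isGivenBy (hp : 1 < p) (hq : q ≠ 0) (hu : MemLorentz p q volume u) :
    ∃ T : 𝓢'(𝔼, ℂ), IsGivenBy T u := by
  replace hu := hu.weak hq
  obtain ⟨C, hC, H⟩ := exists_lintegral_kernel_le_weak (G := 𝔼) (μ := volume) hp
  obtain ⟨k, D, hD⟩ := eLpNorm_le_seminorm ℂ ℂ 1 (volume : Measure 𝔼)
  set P := (Finset.Iic ((k, 0) : ℕ × ℕ)).sup (schwartzSeminormFamily ℂ 𝔼 ℂ) with hP
  set N := lorentzNorm p ∞ volume u with hN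
  have hbound : ∀ φ : 𝓢(𝔼, ℂ), ∫⁻ y, ‖φ y * u y‖ₑ ≤
      ENNReal.ofReal ((C * (D + 1) * N).toReal * P φ) := by
    intro φ
    have h1 : ∫⁻ y, ‖φ y‖ₑ ≤ (D + 1) * ENNReal.ofReal (P φ) := by
      rw [← eLpNorm_one_eq_lintegral_enorm]
      exact (hD φ).trans (mul_le_mul_left le_self_add _)
    have h2 : ∀ y, ‖φ y‖ₑ ≤ (D + 1) * ENNReal.ofReal (P φ) / ENNReal.ofReal 1 := by
      intro y
      rw [ENNReal.ofReal_one, div_one, ← ofReal_norm]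
      refine le_trans (ENNReal.ofReal_le_ofReal ?_) (le_mul_of_one_le_left' le_add_self)
      refine (norm_le_seminorm ℂ φ y).trans ?_
      exact (Finset.le_sup (f := schwartzSeminormFamily ℂ 𝔼 ℂ)
        (show ((0, 0) : ℕ × ℕ) ∈ Finset.Iic ((k, 0) : ℕ × ℕ) by simp)) φ
    have h3 := H (fun y => ‖φ y‖ₑ) u _ 1 (by fun_prop) one_pos h1 h2 0
    simp only [sub_zero, ENNReal.ofReal_one, ENNReal.one_rpow, mul_one] at h3
    simp only [enorm_mul]
    refine h3.trans (le_of_eq ?_)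
    rw [ENNReal.ofReal_mul ENNReal.toReal_nonneg, ENNReal.ofReal_toReal
      (ENNReal.mul_ne_top (ENNReal.mul_ne_top hC (by simp)) hu.2.ne)]
    ring
  have hint : ∀ φ : 𝓢(𝔼, ℂ), Integrable (fun x => φ x * u x) volume := fun φ =>
    ⟨φ.continuous.aestronglyMeasurable.mul hu.1, (hbound φ).trans_lt ENNReal.ofReal_lt_top⟩
  let L : 𝓢(𝔼, ℂ) →L[ℂ] ℂ := mkCLMtoNormedSpace (fun φ => ∫ x, φ x * u x)
    (fun φ ψ => by
      rw [← integral_add (hint φ) (hint ψ)]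
      simp [add_mul])
    (fun a φ => by
      rw [RingHom.id_apply, smul_eq_mul, ← integral_const_mul]
      simp [mul_assoc])
    ⟨_, _, ENNReal.toReal_nonneg, fun φ => by
      have h := (enorm_integral_le_lintegral_enorm fun x => φ x * u x).trans (hbound φ)
      rw [← ofReal_norm] at h
      exact (ENNReal.ofReal_le_ofReal_iff
        (mul_nonneg ENNReal.toReal_nonneg (apply_nonneg _ _))).1 h⟩
  exact ⟨ContinuousLinearMap.toPointwiseConvergenceCLM _ _ _ _ L, fun φ => ⟨hint φ, rfl⟩⟩

/-! ### Multipliers as convolutions -/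

/-- The Fourier transform turns the product `m · 𝓕⁻¹φ` into the convolution of `𝓕 m` and `φ`. -/
lemma fourier_smulLeftCLM_fourierInv_apply (m φ : 𝓢(𝔼, ℂ)) (y : 𝔼) :
    (𝓕 (SchwartzMap.smulLeftCLM ℂ m (𝓕⁻ φ)) : 𝓢(𝔼, ℂ)) y =
      ∫ x, (𝓕 m : 𝓢(𝔼, ℂ)) (y - x) * φ x := by
  set B := ContinuousLinearMap.mul ℂ ℂ
  have h : SchwartzMap.smulLeftCLM ℂ m (𝓕⁻ φ) = 𝓕⁻ (SchwartzMap.convolution B (𝓕 m) φ) := by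
    ext x
    rw [SchwartzMap.smulLeftCLM_apply_apply m.hasTemperateGrowth, smul_eq_mul]
    have h1 : ∀ ψ : 𝓢(𝔼, ℂ), (𝓕⁻ ψ : 𝓢(𝔼, ℂ)) x = (𝓕 ψ : 𝓢(𝔼, ℂ)) (-x) := fun ψ => by
      rw [SchwartzMap.fourierInv_coe, SchwartzMap.fourier_coe, Real.fourierInv_eq_fourier_neg]
    rw [h1 (SchwartzMap.convolution B (𝓕 m) φ), SchwartzMap.fourier_convolution,
      SchwartzMap.pairing_apply_apply, ContinuousLinearMap.mul_apply', ← h1, ← h1,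
      FourierTransform.fourierInv_fourier_eq]
  rw [h, FourierTransform.fourier_fourierInv_eq, SchwartzMap.convolution_apply,
    MeasureTheory.convolution_eq_swap]
  rfl

/-- A Fourier multiplier with Schwartz symbol acts on weak `L^p` as a convolution. -/
lemma IsGivenBy.fourierMultiplierCLM (hp : 1 < p) (hu : MemLorentz p ∞ volume u)
    (h : IsGivenBy T u) (m : 𝓢(𝔼, ℂ)) :
    IsGivenBy (TemperedDistribution.fourierMultiplierCLM ℂ m T)
      (fun x => ∫ y, (𝓕 m : 𝓢(𝔼, ℂ)) (y - x) * u y) := by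
  set K : 𝓢(𝔼, ℂ) := 𝓕 m with hK
  obtain ⟨C, hC, H⟩ := exists_lintegral_kernel_le_weak (G := 𝔼) (μ := volume) hp
  obtain ⟨D, hDt, hD⟩ : ∃ D : ℝ≥0∞, D ≠ ∞ ∧ ∀ x, ∫⁻ y, ‖K (y - x)‖ₑ * ‖u y‖ₑ ≤ D := by
    have hA : (∫⁻ x, ‖K x‖ₑ) ≠ ∞ := K.integrable.2.ne
    refine ⟨C * ((∫⁻ x, ‖K x‖ₑ) + ENNReal.ofReal (SchwartzMap.seminorm ℂ 0 0 K)) *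
      ENNReal.ofReal 1 ^ (-(p⁻¹).toReal) * lorentzNorm p ∞ volume u, ?_,
      H (fun x => ‖K x‖ₑ) u _ 1 (by fun_prop) one_pos le_self_add fun x => ?_⟩
    · refine ENNReal.mul_ne_top (ENNReal.mul_ne_top (ENNReal.mul_ne_top hC ?_) (by simp)) hu.2.ne
      exact ENNReal.add_ne_top.2 ⟨hA, ENNReal.ofReal_ne_top⟩
    · rw [ENNReal.ofReal_one, div_one, ← ofReal_norm]
      exact (ENNReal.ofReal_le_ofReal (norm_le_seminorm ℂ K x)).trans le_add_self
  intro φ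
  have hint : Integrable (Function.uncurry fun x y => φ x * (K (y - x) * u y))
      ((volume : Measure 𝔼).prod volume) := by
    have hmeas : AEStronglyMeasurable (Function.uncurry fun x y => φ x * (K (y - x) * u y))
        ((volume : Measure 𝔼).prod volume) := by
      refine AEStronglyMeasurable.mul ?_ (AEStronglyMeasurable.mul ?_ hu.1.comp_snd)
      · exact (φ.continuous.comp continuous_fst).aestronglyMeasurable
      · exact (K.continuous.comp (continuous_snd.sub continuous_fst)).aestronglyMeasurable
    refine ⟨hmeas, ?_⟩
    rw [HasFiniteIntegral, lintegral_prod _ hmeas.enorm]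
    calc ∫⁻ x, ∫⁻ y, ‖φ x * (K (y - x) * u y)‖ₑ
        = ∫⁻ x, ‖φ x‖ₑ * ∫⁻ y, ‖K (y - x)‖ₑ * ‖u y‖ₑ := by
          refine lintegral_congr fun x => ?_
          rw [← lintegral_const_mul' _ _ enorm_ne_top]
          simp only [enorm_mul]
      _ ≤ ∫⁻ x, ‖φ x‖ₑ * D := by
          gcongr with x
          exact hD x
      _ < ∞ := by
          rw [lintegral_mul_const' _ _ hDt]
          exact ENNReal.mul_lt_top φ.integrable.2 hDt.lt_top
  have hleft := hint.integral_prod_left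
  simp only [Function.uncurry_apply_pair, integral_const_mul] at hleft
  refine ⟨hleft, ?_⟩
  rw [TemperedDistribution.fourierMultiplierCLM_apply_apply, (h _).2]
  simp only [← integral_const_mul]
  rw [integral_integral_swap hint]
  refine integral_congr_ae (Filter.Eventually.of_forall fun y => ?_)
  simp only
  rw [fourier_smulLeftCLM_fourierInv_apply, ← integral_mul_const]
  refine integral_congr_ae (Filter.Eventually.of_forall fun x => ?_)
  simp only [hK]
  ring

end Given

/-! ### Distributions vanish off their support -/

section Support

open Distribution

variable {E : Type*} [NormedAddCommGroup E] [InnerProductSpace ℝ E] [FiniteDimensional ℝ E]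

/-- A partition of unity shows that a tempered distribution annihilates compactly supported test
functions that vanish near its support. -/
lemma apply_eq_zero_of_hasCompactSupport (S : 𝓢'(E, ℂ)) (φ : 𝓢(E, ℂ)) (hφ : HasCompactSupport φ)
    (h : Disjoint (tsupport φ) (dsupport S)) : S φ = 0 := by
  have hcov : tsupport φ ⊆ ⋃ a : {a : Set E // IsVanishingOn S a ∧ IsOpen a}, (a : Set E) := by
    intro x hx
    have := Set.disjoint_left.1 h hx
    rw [notMem_dsupport_iff] at this
    obtain ⟨s, hs, ho, hxs⟩ := this
    exact Set.mem_iUnion.2 ⟨⟨s, hs, ho⟩, hxs⟩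
  obtain ⟨f, hf⟩ := SmoothPartitionOfUnity.exists_isSubordinate (modelWithCornersSelf ℝ E)
    (isClosed_tsupport φ) _ (fun a => a.2.2) hcov
  have hfin := f.locallyFinite.finite_nonempty_inter_compact hφ
  have hc : ∀ i, HasCompactSupport fun x => Complex.ofRealCLM (f i x) * φ x := fun i => hφ.mul_left
  have hs : ∀ i, ContDiff ℝ ((⊤ : ℕ∞) : WithTop ℕ∞) fun x => Complex.ofRealCLM (f i x) * φ x :=
    fun i => (Complex.ofRealCLM.contDiff.comp (f i).contMDiff.contDiff).mul (φ.smooth _)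
  have hsum : φ = ∑ i ∈ hfin.toFinset, (hc i).toSchwartzMap (hs i) := by
    ext x
    rw [sum_apply]
    simp only [HasCompactSupport.toSchwartzMap_toFun]
    by_cases hx : x ∈ tsupport φ
    · have h1 := f.sum_eq_one hx
      rw [finsum_eq_sum_of_support_subset (s := hfin.toFinset) _ fun i hi => by
        simp only [Set.Finite.coe_toFinset, Set.mem_ofPred_eq]
        exact ⟨x, hi, hx⟩] at h1
      rw [← Finset.sum_mul, ← map_sum, h1]
      simp
    · simp [image_eq_zero_of_notMem_tsupport hx]
  rw [hsum, map_sum]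
  refine Finset.sum_eq_zero fun i _ => i.2.1 _ (subset_trans ?_ (hf i))
  refine closure_mono fun x hx => ?_
  contrapose! hx
  simp only [Function.mem_support, not_not] at hx ⊢
  simp [hx]

/-- Smooth cutoffs `χ(x / (N + 1)) φ` converge to `φ` in the Schwartz space. -/
lemma exists_hasCompactSupport_tendsto (φ : 𝓢(E, ℂ)) :
    ∃ Φ : ℕ → 𝓢(E, ℂ), (∀ N, HasCompactSupport (Φ N)) ∧ (∀ N, tsupport (Φ N) ⊆ tsupport φ) ∧
      Filter.Tendsto Φ Filter.atTop (nhds φ) := by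
  let b : ContDiffBump (0 : E) := ⟨1, 2, one_pos, one_lt_two⟩
  let β : E → ℂ := fun x => Complex.ofRealCLM (b x)
  have hβc : HasCompactSupport β := b.hasCompactSupport.comp_left (map_zero _)
  have hβs : ∀ {r : ℕ∞}, ContDiff ℝ r β := fun {r} => Complex.ofRealCLM.contDiff.comp b.contDiff
  let ψ : E → ℂ := fun x => 1 - β x
  have hψs : ∀ {r : ℕ∞}, ContDiff ℝ r ψ := fun {r} => contDiff_const.sub hβs
  have hψb : ∀ i : ℕ, ∃ B : ℝ, 0 ≤ B ∧ ∀ x, ‖iteratedFDeriv ℝ i ψ x‖ ≤ B := by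
    intro i
    obtain ⟨B, hB⟩ := (hβc.iteratedFDeriv (𝕜 := ℝ) i).exists_bound_of_continuous
      (hβs (r := i).continuous_iteratedFDeriv le_rfl)
    have hB0 : 0 ≤ B := (norm_nonneg _).trans (hB 0)
    refine ⟨1 + B, by positivity, fun x => ?_⟩
    have hsub : iteratedFDeriv ℝ i ψ x =
        iteratedFDeriv ℝ i (fun _ : E => (1 : ℂ)) x - iteratedFDeriv ℝ i β x :=
      iteratedFDeriv_sub_apply contDiff_const.contDiffAt (hβs (r := i)).contDiffAt
    rw [hsub]
    refine (norm_sub_le _ _).trans (add_le_add ?_ (hB x))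
    rcases Nat.eq_zero_or_pos i with rfl | hi
    · simp
    · rw [iteratedFDeriv_const_of_ne hi.ne']
      simp
  choose B hB0 hB using hψb
  let c : ℕ → ℝ := fun N => 1 / ((N : ℝ) + 1)
  have hc0 : ∀ N, 0 < c N := fun N => by positivity
  have hc1 : ∀ N, c N ≤ 1 := fun N => by
    rw [div_le_one (by positivity)]
    linarith [(Nat.cast_nonneg N : (0 : ℝ) ≤ N)]
  have hcc : ∀ N, HasCompactSupport fun x => β (c N • x) * φ x := fun N =>
    (hβc.comp_smul (hc0 N).ne').mul_right
  have hcs : ∀ N, ContDiff ℝ ((⊤ : ℕ∞) : WithTop ℕ∞) fun x => β (c N • x) * φ x := fun N =>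
    (hβs.comp (contDiff_const_smul _)).mul (φ.smooth _)
  refine ⟨fun N => (hcc N).toSchwartzMap (hcs N), hcc, fun N => ?_, ?_⟩
  · refine closure_mono fun x hx => ?_
    contrapose! hx
    simp only [Function.mem_support, not_not] at hx ⊢
    simp [hx]
  rw [(schwartz_withSeminorms ℝ E ℂ).tendsto_nhds]
  rintro ⟨k, l⟩ ε hε
  set D := ∑ i ∈ Finset.range (l + 1), (l.choose i : ℝ) * B i *
    SchwartzMap.seminorm ℝ (k + 1) (l - i) φ with hD
  have hD0 : 0 ≤ D := Finset.sum_nonneg fun i _ =>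
    mul_nonneg (mul_nonneg (by positivity) (hB0 i)) (apply_nonneg _ _)
  have hbound : ∀ N, SchwartzMap.seminorm ℝ k l ((hcc N).toSchwartzMap (hcs N) - φ) ≤ c N * D := by
    intro N
    refine SchwartzMap.seminorm_le_bound ℝ k l _ (mul_nonneg (hc0 N).le hD0) fun x => ?_
    have hfun : ⇑((hcc N).toSchwartzMap (hcs N) - φ) = -fun x => ψ (c N • x) * φ x := by
      funext y
      simp only [sub_apply, HasCompactSupport.toSchwartzMap_toFun, Pi.neg_apply, ψ]
      ring
    rw [hfun, iteratedFDeriv_neg_apply, norm_neg]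
    rcases lt_or_ge ‖c N • x‖ 1 with hx | hx
    · -- Near such a point the cutoff is identically `1`.
      have hz : (fun x => ψ (c N • x) * φ x) =ᶠ[nhds x] fun _ => 0 := by
        have : ∀ᶠ y in nhds x, ‖c N • y‖ < 1 :=
          (continuous_norm.comp (continuous_const_smul (c N))).continuousAt.eventually_lt
            continuousAt_const hx
        filter_upwards [this] with y hy
        have hb1 : b (c N • y) = 1 := b.one_of_mem_closedBall (by simpa using hy.le)
        simp [ψ, β, hb1]
      rw [(hz.iteratedFDeriv ℝ l).eq_of_nhds]
      simp only [iteratedFDeriv_fun_zero, Pi.zero_apply, norm_zero, mul_zero]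
      exact mul_nonneg (hc0 N).le hD0
    · have h1 : 1 ≤ c N * ‖x‖ := by
        rwa [norm_smul, Real.norm_of_nonneg (hc0 N).le] at hx
      have hleib := norm_iteratedFDeriv_mul_le (𝕜 := ℝ) (N := l) (f := fun x => ψ (c N • x))
        (g := φ) (hψs (r := l) |>.comp (contDiff_const_smul _)) (φ.smooth l) x le_rfl
      refine (mul_le_mul_of_nonneg_left hleib (by positivity)).trans ?_
      rw [Finset.mul_sum, hD, Finset.mul_sum]
      refine Finset.sum_le_sum fun i _ => ?_
      have hder : ‖iteratedFDeriv ℝ i (fun x => ψ (c N • x)) x‖ ≤ B i := by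
        rw [iteratedFDeriv_comp_const_smul (c N) (hψs (r := i)), norm_smul, norm_pow,
          Real.norm_of_nonneg (hc0 N).le]
        calc _ ≤ 1 * B i := mul_le_mul (pow_le_one₀ (hc0 N).le (hc1 N)) (hB i _)
              (norm_nonneg _) zero_le_one
          _ = B i := one_mul _
      have hsem := SchwartzMap.le_seminorm ℝ (k + 1) (l - i) φ x
      calc ‖x‖ ^ k * (↑(l.choose i) * ‖iteratedFDeriv ℝ i (fun x => ψ (c N • x)) x‖ *
            ‖iteratedFDeriv ℝ (l - i) φ x‖)
          ≤ ‖x‖ ^ k * (↑(l.choose i) * B i * ‖iteratedFDeriv ℝ (l - i) φ x‖) := by gcongr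
        _ = 1 * (↑(l.choose i) * B i * (‖x‖ ^ k * ‖iteratedFDeriv ℝ (l - i) φ x‖)) := by ring
        _ ≤ (c N * ‖x‖) * (↑(l.choose i) * B i * (‖x‖ ^ k * ‖iteratedFDeriv ℝ (l - i) φ x‖)) := by
            refine mul_le_mul_of_nonneg_right h1 ?_
            have := hB0 i
            positivity
        _ = c N * (↑(l.choose i) * B i * (‖x‖ ^ (k + 1) * ‖iteratedFDeriv ℝ (l - i) φ x‖)) := by
            ring
        _ ≤ _ := by
            have := hB0 i
            have := (hc0 N).le
            gcongr
  have hlim : Filter.Tendsto (fun N => c N * D) Filter.atTop (nhds 0) := by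
    simpa [c] using tendsto_one_div_add_atTop_nhds_zero_nat.mul_const D
  filter_upwards [hlim.eventually (gt_mem_nhds hε)] with N hN
  exact (hbound N).trans_lt hN

/-- A tempered distribution annihilates every Schwartz function that vanishes near its support. -/
lemma apply_eq_zero_of_disjoint_dsupport (S : 𝓢'(E, ℂ)) (φ : 𝓢(E, ℂ))
    (h : Disjoint (tsupport φ) (dsupport S)) : S φ = 0 := by
  obtain ⟨Φ, hc, hs, hlim⟩ := exists_hasCompactSupport_tendsto φ
  have h1 : Filter.Tendsto (fun N => S (Φ N)) Filter.atTop (nhds (S φ)) :=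
    (ContinuousLinearMap.continuous (S : 𝓢(E, ℂ) →L[ℂ] ℂ)).continuousAt.tendsto.comp hlim
  have h2 : ∀ N, S (Φ N) = 0 := fun N =>
    apply_eq_zero_of_hasCompactSupport S _ (hc N) (h.mono_left (hs N))
  simp only [h2] at h1
  exact tendsto_nhds_unique h1 tendsto_const_nhds |>.symm ▸ rfl

lemma smulLeftCLM_eq_of_eqOn {S : 𝓢'(E, ℂ)} {g₁ g₂ : E → ℂ} {V : Set E}
    (h₁ : g₁.HasTemperateGrowth) (h₂ : g₂.HasTemperateGrowth) (hV : IsOpen V)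
    (hS : dsupport S ⊆ V) (h : Set.EqOn g₁ g₂ V) :
    TemperedDistribution.smulLeftCLM ℂ g₁ S = TemperedDistribution.smulLeftCLM ℂ g₂ S := by
  ext φ
  rw [TemperedDistribution.smulLeftCLM_apply_apply, TemperedDistribution.smulLeftCLM_apply_apply,
    ← sub_eq_zero, ← map_sub]
  refine apply_eq_zero_of_disjoint_dsupport S _ ?_
  have hsupp : tsupport (SchwartzMap.smulLeftCLM ℂ g₁ φ - SchwartzMap.smulLeftCLM ℂ g₂ φ) ⊆ Vᶜ := by
    refine closure_minimal (fun x hx hxV => hx ?_) hV.isClosed_compl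
    rw [sub_apply, SchwartzMap.smulLeftCLM_apply_apply h₁,
      SchwartzMap.smulLeftCLM_apply_apply h₂, h hxV, sub_self]
  exact (Set.disjoint_compl_left_iff_subset.2 hS).mono_left hsupp

end Support

/-! ### Dilated Schwartz multipliers on Lorentz spaces -/

section Multiplier

variable {n : ℕ} {T : 𝓢'(EuclideanSpace ℝ (Fin n), ℂ)} {u : EuclideanSpace ℝ (Fin n) → ℂ}
  {p q l : ℝ≥0∞}

local notation "𝔼" => EuclideanSpace ℝ (Fin n)

/-- The dilation `ξ ↦ m (ξ / L)` of a Schwartz function (for `L ≠ 0`; it is `m` itself if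
`L = 0`). -/
noncomputable def dilate (L : ℝ) (m : 𝓢(𝔼, ℂ)) : 𝓢(𝔼, ℂ) :=
  if h : L = 0 then m else
    compCLMOfContinuousLinearEquiv ℂ
      (ContinuousLinearEquiv.smulLeft (Units.mk0 L⁻¹ (inv_ne_zero h)) : 𝔼 ≃L[ℝ] 𝔼) m

lemma dilate_apply {L : ℝ} (hL : 0 < L) (m : 𝓢(𝔼, ℂ)) (ξ : 𝔼) : dilate L m ξ = m (L⁻¹ • ξ) := by
  rw [dilate, dif_neg hL.ne']
  rfl

lemma fourier_dilate_apply {L : ℝ} (hL : 0 < L) (m : 𝓢(𝔼, ℂ)) (x : 𝔼) :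
    (𝓕 (dilate L m) : 𝓢(𝔼, ℂ)) x = (L ^ n : ℝ) * (𝓕 m : 𝓢(𝔼, ℂ)) (L • x) := by
  rw [SchwartzMap.fourier_coe, SchwartzMap.fourier_coe, Real.fourier_eq, Real.fourier_eq]
  have h := Measure.integral_comp_inv_smul (volume : Measure 𝔼)
    (fun ξ => Real.fourierChar (-inner ℝ ξ (L • x)) • m ξ) L
  rw [finrank_euclideanSpace_fin, abs_of_pos (pow_pos hL n), Complex.real_smul] at h
  rw [← h]
  refine integral_congr_ae (Filter.Eventually.of_forall fun ξ => ?_)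
  simp only [dilate_apply hL, inner_smul_left, inner_smul_right]
  congr 4
  simp [hL.ne']

/-- The kernel of a dilated multiplier has mass independent of the dilation parameter, and height
of order `L ^ n`. -/
lemma exists_kernel_bounds (m : 𝓢(𝔼, ℂ)) :
    ∃ A : ℝ≥0∞, A ≠ ∞ ∧ ∀ (L : ℝ) (c : ℂ), 0 < L →
      ∫⁻ x, ‖(𝓕 (c • dilate L m) : 𝓢(𝔼, ℂ)) x‖ₑ ≤ ‖c‖ₑ * A ∧
      ∀ x, ‖(𝓕 (c • dilate L m) : 𝓢(𝔼, ℂ)) x‖ₑ ≤ ‖c‖ₑ * A / ENNReal.ofReal (L ^ n)⁻¹ := by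
  set K : 𝓢(𝔼, ℂ) := 𝓕 m with hK
  have hA : (∫⁻ x, ‖K x‖ₑ) ≠ ∞ := K.integrable.2.ne
  refine ⟨(∫⁻ x, ‖K x‖ₑ) + ENNReal.ofReal (SchwartzMap.seminorm ℂ 0 0 K),
    ENNReal.add_ne_top.2 ⟨hA, ENNReal.ofReal_ne_top⟩, fun L c hL => ?_⟩
  have hLn : 0 < L ^ n := pow_pos hL n
  have hLn' : ENNReal.ofReal (L ^ n) ≠ 0 := by simpa using hLn
  have heq : ∀ x, ‖(𝓕 (c • dilate L m) : 𝓢(𝔼, ℂ)) x‖ₑ =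
      ‖c‖ₑ * (ENNReal.ofReal (L ^ n) * ‖K (L • x)‖ₑ) := by
    intro x
    rw [FourierTransform.fourier_smul, smul_apply, smul_eq_mul, enorm_mul,
      fourier_dilate_apply hL, enorm_mul, ← hK]
    congr 2
    rw [← ofReal_norm, Complex.norm_real, Real.norm_of_nonneg hLn.le]
  constructor
  · simp only [heq]
    rw [lintegral_const_mul' _ _ enorm_ne_top, lintegral_const_mul' _ _ ENNReal.ofReal_ne_top]
    refine mul_le_mul_right (le_trans (le_of_eq ?_) le_self_add) _
    have hmap := lintegral_map (μ := (volume : Measure 𝔼)) (f := fun x => ‖K x‖ₑ)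
      (g := fun x => L • x) (by fun_prop) (by fun_prop)
    rw [← hmap, Measure.map_addHaar_smul _ hL.ne', lintegral_smul_measure,
      finrank_euclideanSpace_fin, abs_of_pos (inv_pos.2 hLn), smul_eq_mul, ← mul_assoc,
      ENNReal.ofReal_inv_of_pos hLn, ENNReal.mul_inv_cancel hLn' ENNReal.ofReal_ne_top, one_mul]
  · intro x
    rw [heq, ENNReal.ofReal_inv_of_pos hLn, div_eq_mul_inv, inv_inv, mul_assoc,
      mul_comm (ENNReal.ofReal _)]
    gcongr
    rw [← ofReal_norm]
    exact (ENNReal.ofReal_le_ofReal (norm_le_seminorm ℂ K _)).trans le_add_self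

lemma enorm_integral_kernel_le (K : 𝓢(𝔼, ℂ)) (u : 𝔼 → ℂ) (x : 𝔼) :
    ‖∫ y, K (y - x) * u y‖ₑ ≤ ∫⁻ y, ‖K (y - x)‖ₑ * ‖u y‖ₑ := by
  refine (enorm_integral_le_lintegral_enorm _).trans (le_of_eq ?_)
  simp only [enorm_mul]

lemma ofReal_inv_pow_rpow {L : ℝ} (hL : 0 < L) (n : ℕ) (a : ℝ) :
    ENNReal.ofReal (L ^ n)⁻¹ ^ a = ENNReal.ofReal (L ^ (-(n * a))) := by
  rw [ENNReal.ofReal_rpow_of_pos (by positivity), ← Real.rpow_natCast, ← Real.rpow_neg hL.le,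
    ← Real.rpow_mul hL.le, neg_mul]

lemma exists_distLinfty_multiplier_le (hp : 1 < p) (m : 𝓢(𝔼, ℂ)) :
    ∃ C : ℝ≥0∞, C ≠ ∞ ∧ ∀ (L : ℝ) (c : ℂ) (u : 𝔼 → ℂ) (T : 𝓢'(𝔼, ℂ)), 0 < L →
      MemLorentz p ∞ volume u → IsGivenBy T u →
      distLinfty (TemperedDistribution.fourierMultiplierCLM ℂ (c • dilate L m : 𝓢(𝔼, ℂ)) T) ≤
        C * ‖c‖ₑ * ENNReal.ofReal (L ^ (n * (p⁻¹).toReal)) * lorentzNorm p ∞ volume u := by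
  obtain ⟨A, hA, HA⟩ := exists_kernel_bounds m
  obtain ⟨C, hC, H⟩ := exists_lintegral_kernel_le_weak (G := 𝔼) (μ := volume) hp
  refine ⟨C * A, ENNReal.mul_ne_top hC hA, fun L c u T hL hu hT => ?_⟩
  obtain ⟨h1, h2⟩ := HA L c hL
  refine (iInf₂_le _ (hT.fourierMultiplierCLM hp hu _)).trans ?_
  simp only [eLpNorm_exponent_top]
  refine eLpNormEssSup_le_of_ae_enorm_bound (Filter.Eventually.of_forall fun x => ?_)
  refine (enorm_integral_kernel_le _ u x).trans ((H _ u _ _ (by fun_prop)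
    (inv_pos.2 (pow_pos hL n)) h1 h2 x).trans (le_of_eq ?_))
  rw [ofReal_inv_pow_rpow hL, mul_neg, neg_neg]
  ring

lemma exists_distLorentz_multiplier_le_weak (hp : 1 < p) (hpq : p < q) (hq : q ≠ ∞)
    (m : 𝓢(𝔼, ℂ)) :
    ∃ C : ℝ≥0∞, C ≠ ∞ ∧ ∀ (L : ℝ) (c : ℂ) (u : 𝔼 → ℂ) (T : 𝓢'(𝔼, ℂ)), 0 < L →
      MemLorentz p ∞ volume u → IsGivenBy T u →
      distLorentz q 1 (TemperedDistribution.fourierMultiplierCLM ℂ (c • dilate L m : 𝓢(𝔼, ℂ)) T) ≤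
        C * ‖c‖ₑ * ENNReal.ofReal (L ^ (n * ((p⁻¹).toReal - (q⁻¹).toReal))) *
          lorentzNorm p ∞ volume u := by
  obtain ⟨A, hA, HA⟩ := exists_kernel_bounds m
  obtain ⟨C, hC, H⟩ := exists_lorentzNorm_kernel_le_weak (G := 𝔼) (μ := volume) hp hpq hq
  refine ⟨C * A, ENNReal.mul_ne_top hC hA, fun L c u T hL hu hT => ?_⟩
  obtain ⟨h1, h2⟩ := HA L c hL
  refine (iInf₂_le _ (hT.fourierMultiplierCLM hp hu _)).trans ?_
  refine (H _ u _ _ _ (by fun_prop) (inv_pos.2 (pow_pos hL n)) h1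
    (ENNReal.mul_ne_top enorm_ne_top hA) h2 hu.2.ne
    (enorm_integral_kernel_le _ u)).trans (le_of_eq ?_)
  rw [ofReal_inv_pow_rpow hL, ← mul_neg, neg_sub]
  ring

lemma exists_distLorentz_multiplier_le (hq : 1 < q) (hl : l ≠ 0) (m : 𝓢(𝔼, ℂ)) :
    ∃ C : ℝ≥0∞, C ≠ ∞ ∧ ∀ (L : ℝ) (c : ℂ) (T : 𝓢'(𝔼, ℂ)), 0 < L → c ≠ 0 →
      distLorentz q l (TemperedDistribution.fourierMultiplierCLM ℂ (c • dilate L m : 𝓢(𝔼, ℂ)) T) ≤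
        C * ‖c‖ₑ * distLorentz q l T := by
  obtain ⟨A, hA, HA⟩ := exists_kernel_bounds m
  obtain ⟨C, hC, H⟩ := exists_lorentzNorm_kernel_le (G := 𝔼) (μ := volume) hq hl
  refine ⟨C * A + 1, ENNReal.add_ne_top.2 ⟨ENNReal.mul_ne_top hC hA, ENNReal.one_ne_top⟩,
    fun L c T hL hc => ?_⟩
  by_cases hT : distLorentz q l T = ∞
  · rw [hT, ENNReal.mul_top (mul_ne_zero (by simp) (by simpa using hc))]
    exact le_top
  obtain ⟨u, hu⟩ := exists_isGivenBy_of_distLorentz_ne_top hT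
  rw [distLorentz_eq hu] at hT ⊢
  have hmem : MemLorentz q l volume u := ⟨hu.locallyIntegrable.aestronglyMeasurable,
    lt_top_iff_ne_top.2 hT⟩
  obtain ⟨h1, -⟩ := HA L c hL
  refine (iInf₂_le _ (hu.fourierMultiplierCLM hq (hmem.weak hl) _)).trans ?_
  refine (H _ u _ (by fun_prop) (ne_top_of_le_ne_top (ENNReal.mul_ne_top enorm_ne_top hA) h1)
    (enorm_integral_kernel_le _ u)).trans ?_
  refine mul_le_mul_left ?_ _
  calc C * _ ≤ C * (‖c‖ₑ * A) := mul_le_mul_right h1 _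
    _ = C * A * ‖c‖ₑ := by ring
    _ ≤ _ := mul_le_mul_left le_self_add _

end Multiplier

/-! ### Derivatives as Fourier multipliers -/

section Symbol

variable {n k : ℕ}

local notation "𝔼" => EuclideanSpace ℝ (Fin n)

/-- The symbol `(2πi ξ)^α` of `∂^α`. -/
noncomputable def symbol (α : Fin n → ℕ) (ξ : EuclideanSpace ℝ (Fin n)) : ℂ :=
  ∏ i, (2 * Real.pi * Complex.I * ξ i) ^ α i

lemma hasTemperateGrowth_coord_pow (i : Fin n) (a : ℕ) :
    Function.HasTemperateGrowth fun ξ : 𝔼 => (2 * Real.pi * Complex.I * ξ i) ^ a := by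
  have h : Function.HasTemperateGrowth fun ξ : 𝔼 => ((ξ i : ℝ) : ℂ) :=
    (Complex.ofRealCLM.comp (EuclideanSpace.proj i : 𝔼 →L[ℝ] ℝ)).hasTemperateGrowth
  exact ((Function.HasTemperateGrowth.const _).mul h).pow a

lemma iterate_lineDeriv_eq (i : Fin n) (a : ℕ) (T : 𝓢'(𝔼, ℂ)) :
    (fun S' : 𝓢'(𝔼, ℂ) => (∂_{EuclideanSpace.single i (1 : ℝ)} S' : 𝓢'(𝔼, ℂ)))^[a] T =
      TemperedDistribution.fourierMultiplierCLM ℂ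
        (fun ξ : 𝔼 => (2 * Real.pi * Complex.I * ξ i) ^ a) T := by
  induction a with
  | zero => simp
  | succ a ih =>
    rw [Function.iterate_succ_apply', ih, TemperedDistribution.lineDeriv_eq_fourierMultiplierCLM]
    have h : Function.HasTemperateGrowth
        fun ξ : 𝔼 => ((inner ℝ ξ (EuclideanSpace.single i (1 : ℝ)) : ℝ) : ℂ) := by fun_prop
    rw [TemperedDistribution.fourierMultiplierCLM_fourierMultiplierCLM_apply
      (hasTemperateGrowth_coord_pow i a) h, ← smul_apply,
      ← TemperedDistribution.fourierMultiplierCLM_smul ((hasTemperateGrowth_coord_pow i a).mul h)]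
    congr 2
    funext ξ
    simp [EuclideanSpace.inner_single_right, pow_succ]
    ring

lemma hasTemperateGrowth_list_prod (α : Fin n → ℕ) (l : List (Fin n)) :
    Function.HasTemperateGrowth fun ξ : 𝔼 =>
      (l.map fun i => (2 * Real.pi * Complex.I * ξ i) ^ α i).prod := by
  induction l with
  | nil => exact Function.HasTemperateGrowth.const (1 : ℂ)
  | cons i l ih =>
    simp only [List.map_cons, List.prod_cons]
    exact (hasTemperateGrowth_coord_pow i (α i)).mul ih

lemma symbol_eq_list_prod (α : Fin n → ℕ) : symbol α = fun ξ : 𝔼 =>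
    ((List.finRange n).map fun i => (2 * Real.pi * Complex.I * ξ i) ^ α i).prod := by
  funext ξ
  rw [symbol, Fin.prod_univ_def]

lemma hasTemperateGrowth_symbol (α : Fin n → ℕ) : Function.HasTemperateGrowth (symbol α) := by
  rw [symbol_eq_list_prod]
  exact hasTemperateGrowth_list_prod α _

lemma contDiff_symbol (α : Fin n → ℕ) : ContDiff ℝ ((⊤ : ℕ∞) : WithTop ℕ∞) (symbol α) :=
  (hasTemperateGrowth_symbol α).1

lemma multiDeriv_eq (α : Fin n → ℕ) (T : 𝓢'(𝔼, ℂ)) :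
    multiDeriv α T = TemperedDistribution.fourierMultiplierCLM ℂ (symbol α) T := by
  rw [symbol_eq_list_prod, multiDeriv]
  induction List.finRange n with
  | nil => simp
  | cons i l ih =>
    rw [List.foldr_cons, ih, iterate_lineDeriv_eq,
      TemperedDistribution.fourierMultiplierCLM_fourierMultiplierCLM_apply
        (hasTemperateGrowth_list_prod α l) (hasTemperateGrowth_coord_pow i (α i))]
    congr 2
    funext ξ
    simp [mul_comm]

lemma symbol_smul (α : Fin n → ℕ) (c : ℝ) (ξ : 𝔼) :
    symbol α (c • ξ) = (c : ℂ) ^ (∑ i, α i) * symbol α ξ := by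
  simp only [symbol, ← Finset.prod_pow_eq_pow_sum, ← Finset.prod_mul_distrib, ← mul_pow]
  refine Finset.prod_congr rfl fun i _ => ?_
  simp
  ring

lemma fourierMultiplierCLM_eq_of_eqOn {T : 𝓢'(𝔼, ℂ)} {g₁ g₂ : 𝔼 → ℂ} {V : Set 𝔼}
    (h₁ : g₁.HasTemperateGrowth) (h₂ : g₂.HasTemperateGrowth) (hV : IsOpen V)
    (hT : fourierSupport T ⊆ V) (h : Set.EqOn g₁ g₂ V) :
    TemperedDistribution.fourierMultiplierCLM ℂ g₁ T =
      TemperedDistribution.fourierMultiplierCLM ℂ g₂ T := by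
  rw [TemperedDistribution.fourierMultiplierCLM_apply,
    TemperedDistribution.fourierMultiplierCLM_apply, smulLeftCLM_eq_of_eqOn h₁ h₂ hV hT h]

/-- On distributions with spectrum in a ball of radius `L * R`, a derivative of order `k` is
`L ^ k` times a dilated Schwartz multiplier. -/
lemma exists_multiDeriv_eq_multiplier {R : ℝ} (hR : 0 < R) (α : Fin n → ℕ) (hα : ∑ i, α i = k) :
    ∃ m : 𝓢(𝔼, ℂ), ∀ (L : ℝ) (T : 𝓢'(𝔼, ℂ)), 0 < L → fourierSupport T ⊆ ball n (L * R) →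
      multiDeriv α T = TemperedDistribution.fourierMultiplierCLM ℂ
        (((L ^ k : ℝ) : ℂ) • dilate L m : 𝓢(𝔼, ℂ)) T := by
  let b : ContDiffBump (0 : 𝔼) := ⟨R + 1, R + 2, by linarith, by linarith⟩
  have hc : HasCompactSupport fun ξ => symbol α ξ * Complex.ofRealCLM (b ξ) :=
    HasCompactSupport.mul_left (b.hasCompactSupport.comp_left (map_zero _))
  have hs : ContDiff ℝ ((⊤ : ℕ∞) : WithTop ℕ∞) fun ξ => symbol α ξ * Complex.ofRealCLM (b ξ) :=
    (contDiff_symbol α).mul (Complex.ofRealCLM.contDiff.comp b.contDiff)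
  refine ⟨hc.toSchwartzMap hs, fun L T hL hT => ?_⟩
  rw [multiDeriv_eq]
  refine fourierMultiplierCLM_eq_of_eqOn (V := Metric.ball 0 (L * (R + 1)))
    (hasTemperateGrowth_symbol α) (SchwartzMap.hasTemperateGrowth _) Metric.isOpen_ball
    (fun ξ hξ => ?_) fun ξ hξ => ?_
  · have h1 : ‖ξ‖ ≤ L * R := hT hξ
    rw [mem_ball_zero_iff]
    nlinarith
  · rw [mem_ball_zero_iff] at hξ
    have hb : b (L⁻¹ • ξ) = 1 := by
      refine b.one_of_mem_closedBall ?_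
      rw [mem_closedBall_zero_iff, norm_smul, norm_inv, Real.norm_of_nonneg hL.le]
      exact (inv_mul_le_iff₀ hL).2 hξ.le
    rw [smul_apply, dilate_apply hL, HasCompactSupport.toSchwartzMap_toFun, hb, symbol_smul, hα]
    simp [hL.ne']

/-- The sum of squares `∑_{|α| = k} |(2πi ξ)^α|²`. -/
noncomputable def symbolSq (n k : ℕ) (ξ : EuclideanSpace ℝ (Fin n)) : ℂ :=
  ∑ α ∈ Finset.piAntidiag (Finset.univ : Finset (Fin n)) k,
    (starRingEnd ℂ) (symbol α ξ) * symbol α ξ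

lemma symbolSq_ne_zero {ξ : 𝔼} (hξ : ξ ≠ 0) : symbolSq n k ξ ≠ 0 := by
  obtain ⟨i, hi⟩ : ∃ i, ξ i ≠ 0 := by
    by_contra! h
    exact hξ (by ext i; simp [h i])
  have hmem : Pi.single i k ∈ Finset.piAntidiag (Finset.univ : Finset (Fin n)) k := by
    simp [Finset.mem_piAntidiag]
  have hpos : 0 < Complex.normSq (symbol (Pi.single i k) ξ) := by
    refine Complex.normSq_pos.2 (Finset.prod_ne_zero_iff.2 fun j _ => ?_)
    rcases eq_or_ne j i with rfl | hj
    · exact pow_ne_zero _ (by simp [hi, Real.pi_ne_zero])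
    · simp [hj]
  have : symbolSq n k ξ = ((∑ α ∈ Finset.piAntidiag (Finset.univ : Finset (Fin n)) k,
      Complex.normSq (symbol α ξ) : ℝ) : ℂ) := by
    simp [symbolSq, Complex.normSq_eq_conj_mul_self]
  rw [this, Complex.ofReal_ne_zero]
  exact (Finset.sum_pos' (f := fun α => Complex.normSq (symbol α ξ))
    (fun α _ => Complex.normSq_nonneg _) ⟨_, hmem, hpos⟩).ne'

/-- A distribution with spectrum in an annulus is recovered from its derivatives of order `k` by
Schwartz multipliers: away from the origin `∑_{|α| = k} |ξ^α|²` does not vanish. -/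
lemma exists_eq_sum_multiplier_multiDeriv {r₁ r₂ : ℝ} (hr₁ : 0 < r₁) (hr : r₁ < r₂) (n k : ℕ) :
    ∃ m : (Fin n → ℕ) → 𝓢(EuclideanSpace ℝ (Fin n), ℂ),
      ∀ (L : ℝ) (T : 𝓢'(EuclideanSpace ℝ (Fin n), ℂ)), 0 < L →
        fourierSupport T ⊆ annulus n (L * r₁) (L * r₂) →
        T = ∑ α ∈ Finset.piAntidiag (Finset.univ : Finset (Fin n)) k,
          TemperedDistribution.fourierMultiplierCLM ℂ
            ((((L ^ k)⁻¹ : ℝ) : ℂ) • dilate L (m α) : 𝓢(EuclideanSpace ℝ (Fin n), ℂ))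
            (multiDeriv α T) := by
  let E := EuclideanSpace ℝ (Fin n)
  let b₁ : ContDiffBump (0 : E) := ⟨r₁ / 4, r₁ / 2, by linarith, by linarith⟩
  let b₂ : ContDiffBump (0 : E) := ⟨r₂ + 1, r₂ + 2, by linarith, by linarith⟩
  -- A cutoff equal to `1` near the annulus and to `0` near the origin.
  let χ : E → ℂ := fun ξ => Complex.ofRealCLM (b₂ ξ) - Complex.ofRealCLM (b₁ ξ)
  have hχs : ContDiff ℝ ((⊤ : ℕ∞) : WithTop ℕ∞) χ :=
    (Complex.ofRealCLM.contDiff.comp b₂.contDiff).sub (Complex.ofRealCLM.contDiff.comp b₁.contDiff)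
  have hχc : HasCompactSupport χ :=
    (b₂.hasCompactSupport.comp_left (map_zero _)).sub (b₁.hasCompactSupport.comp_left (map_zero _))
  have hχ0 : ∀ ξ : E, ‖ξ‖ < r₁ / 4 → χ ξ = 0 := fun ξ hξ => by
    have h1 : b₁ ξ = 1 := b₁.one_of_mem_closedBall (by simpa [b₁] using hξ.le)
    have h2 : b₂ ξ = 1 := b₂.one_of_mem_closedBall (by
      rw [mem_closedBall_zero_iff]
      change ‖ξ‖ ≤ r₂ + 1
      linarith)
    simp [χ, h1, h2]
  have hχ1 : ∀ ξ : E, r₁ / 2 < ‖ξ‖ → ‖ξ‖ < r₂ + 1 → χ ξ = 1 := fun ξ h h' => by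
    have h1 : b₁ ξ = 0 := b₁.zero_of_le_dist (by simpa [b₁] using h.le)
    have h2 : b₂ ξ = 1 := b₂.one_of_mem_closedBall (by simpa [b₂] using h'.le)
    simp [χ, h1, h2]
  let conjSymbol : (Fin n → ℕ) → E → ℂ := fun α ξ => (starRingEnd ℂ) (symbol α ξ)
  have hconj : ∀ α, ContDiff ℝ ((⊤ : ℕ∞) : WithTop ℕ∞) (conjSymbol α) := fun α =>
    Complex.conjCLE.contDiff.comp (contDiff_symbol α)
  have hsq : ContDiff ℝ ((⊤ : ℕ∞) : WithTop ℕ∞) (symbolSq n k) :=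
    ContDiff.sum fun α _ => (hconj α).mul (contDiff_symbol α)
  have hs : ∀ α, ContDiff ℝ ((⊤ : ℕ∞) : WithTop ℕ∞)
      fun ξ => χ ξ * (conjSymbol α ξ / symbolSq n k ξ) := by
    intro α
    rw [contDiff_iff_contDiffAt]
    intro ξ
    rcases eq_or_ne ξ 0 with rfl | hξ
    · refine (contDiffAt_const (c := (0 : ℂ))).congr_of_eventuallyEq ?_
      filter_upwards [Metric.ball_mem_nhds (0 : E) (show 0 < r₁ / 4 by linarith)] with ξ hξ
      rw [hχ0 ξ (by simpa using hξ), zero_mul]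
    · simp only [div_eq_mul_inv]
      exact hχs.contDiffAt.mul
        ((hconj α).contDiffAt.mul (hsq.contDiffAt.inv (symbolSq_ne_zero hξ)))
  have hc : ∀ α, HasCompactSupport fun ξ => χ ξ * (conjSymbol α ξ / symbolSq n k ξ) := fun α =>
    hχc.mul_right
  refine ⟨fun α => (hc α).toSchwartzMap (hs α), fun L T hL hT => ?_⟩
  set m : (Fin n → ℕ) → 𝓢(E, ℂ) := fun α => (hc α).toSchwartzMap (hs α)
  have hgrowth : ∀ α, Function.HasTemperateGrowth
      (symbol α * ⇑((((L ^ k)⁻¹ : ℝ) : ℂ) • dilate L (m α) : 𝓢(E, ℂ))) := fun α =>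
    (hasTemperateGrowth_symbol α).mul (SchwartzMap.hasTemperateGrowth _)
  have hcomp : ∀ α, TemperedDistribution.fourierMultiplierCLM ℂ
      ((((L ^ k)⁻¹ : ℝ) : ℂ) • dilate L (m α) : 𝓢(E, ℂ)) (multiDeriv α T) =
      TemperedDistribution.fourierMultiplierCLM ℂ
        (symbol α * ⇑((((L ^ k)⁻¹ : ℝ) : ℂ) • dilate L (m α) : 𝓢(E, ℂ))) T := fun α => by
    rw [multiDeriv_eq, TemperedDistribution.fourierMultiplierCLM_fourierMultiplierCLM_apply
      (hasTemperateGrowth_symbol α) (SchwartzMap.hasTemperateGrowth _)]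
  have hsum := TemperedDistribution.fourierMultiplierCLM_sum ℂ
    (s := Finset.piAntidiag (Finset.univ : Finset (Fin n)) k) fun α _ => hgrowth α
  simp only [hcomp]
  rw [← sum_apply, ← hsum]
  have hone : T = TemperedDistribution.fourierMultiplierCLM ℂ (fun _ : E => (1 : ℂ)) T := by simp
  conv_lhs => rw [hone]
  refine fourierMultiplierCLM_eq_of_eqOn
    (V := {ξ | L * (r₁ / 2) < ‖ξ‖} ∩ {ξ | ‖ξ‖ < L * (r₂ + 1)})
    (Function.HasTemperateGrowth.const _) (Function.HasTemperateGrowth.sum fun α _ => hgrowth α)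
    ((isOpen_lt continuous_const continuous_norm).inter
      (isOpen_lt continuous_norm continuous_const)) (fun ξ hξ => ?_) fun ξ hξ => ?_
  · obtain ⟨h1, h2⟩ := hT hξ
    exact ⟨by simp only [Set.mem_ofPred_eq]; nlinarith, by simp only [Set.mem_ofPred_eq]; nlinarith⟩
  · obtain ⟨h1, h2⟩ := hξ
    simp only [Set.mem_ofPred_eq] at h1 h2
    set η : E := L⁻¹ • ξ with hη
    have hηn : ‖η‖ = L⁻¹ * ‖ξ‖ := by
      rw [hη, norm_smul, norm_inv, Real.norm_of_nonneg hL.le]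
    have h1' : r₁ / 2 < ‖η‖ := by rwa [hηn, lt_inv_mul_iff₀ hL]
    have h2' : ‖η‖ < r₂ + 1 := by rwa [hηn, inv_mul_lt_iff₀ hL]
    have hη0 : η ≠ 0 := norm_pos_iff.1 (lt_trans (by linarith) h1')
    have hterm : ∀ α ∈ Finset.piAntidiag (Finset.univ : Finset (Fin n)) k,
        (symbol α * ⇑((((L ^ k)⁻¹ : ℝ) : ℂ) • dilate L (m α) : 𝓢(E, ℂ))) ξ =
          conjSymbol α η * symbol α η / symbolSq n k η := by
      intro α hα
      have hαk : ∑ i, α i = k := (Finset.mem_piAntidiag.1 hα).1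
      rw [Pi.mul_apply, smul_apply, dilate_apply hL, ← hη]
      simp only [m, HasCompactSupport.toSchwartzMap_toFun]
      rw [hχ1 η h1' h2', hη, symbol_smul α, hαk, ← hη]
      simp only [smul_eq_mul, Complex.ofReal_inv, Complex.ofReal_pow, inv_pow]
      ring
    rw [Finset.sum_congr rfl hterm, ← Finset.sum_div]
    exact (div_self (symbolSq_ne_zero hη0)).symm

end Symbol

/-! ### The Bernstein inequalities -/

section Bernstein

variable {n k : ℕ} {p q l : ℝ≥0∞}

local notation "𝔼" => EuclideanSpace ℝ (Fin n)

/-- Constants may be chosen uniformly over the finitely many multi-indices of order `k`. -/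
lemma exists_supDeriv_le {X : Type*} {P : X → Prop} {τ : X → 𝓢'(𝔼, ℂ)} {B : X → ℝ≥0∞}
    {N : 𝓢'(𝔼, ℂ) → ℝ≥0∞}
    (H : ∀ α : Fin n → ℕ, ∑ i, α i = k →
      ∃ C : ℝ≥0∞, C ≠ ∞ ∧ ∀ x, P x → N (multiDeriv α (τ x)) ≤ C * B x) :
    ∃ C : ℝ, 0 < C ∧ ∀ x, P x → supDeriv k N (τ x) ≤ ENNReal.ofReal C * B x := by
  choose! C hC H using H
  set s := Finset.piAntidiag (Finset.univ : Finset (Fin n)) k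
  have hs : ∀ α, α ∈ s ↔ ∑ i, α i = k := fun α => by simp [s, Finset.mem_piAntidiag]
  have hD : ∑ α ∈ s, C α ≠ ∞ := ENNReal.sum_ne_top.2 fun α hα => hC α ((hs α).1 hα)
  refine ⟨(∑ α ∈ s, C α).toReal + 1, by positivity, fun x hx => iSup₂_le fun α hα => ?_⟩
  refine (H α hα x hx).trans (mul_le_mul_left ?_ _)
  rw [ENNReal.ofReal_add ENNReal.toReal_nonneg zero_le_one, ENNReal.ofReal_toReal hD]
  exact (Finset.single_le_sum (f := C) (fun _ _ => bot_le) ((hs α).2 hα)).trans le_self_add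

lemma enorm_ofReal_pow {L : ℝ} (hL : 0 < L) (k : ℕ) :
    ‖((L ^ k : ℝ) : ℂ)‖ₑ = ENNReal.ofReal (L ^ k) := by
  rw [← ofReal_norm, Complex.norm_real, Real.norm_of_nonneg (by positivity)]

lemma ofReal_mul_pow_mul_rpow {C L : ℝ} (hC : 0 < C) (hL : 0 < L) (k : ℕ) (a : ℝ) :
    ENNReal.ofReal (C * L ^ ((k : ℝ) + a)) =
      ENNReal.ofReal C * (ENNReal.ofReal (L ^ k) * ENNReal.ofReal (L ^ a)) := by
  rw [Real.rpow_add hL, Real.rpow_natCast, ENNReal.ofReal_mul hC.le,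
    ENNReal.ofReal_mul (by positivity)]

lemma exists_supDeriv_distLinfty_le {R : ℝ} (hR : 0 < R) (n k : ℕ) (hp : 1 < p) :
    ∃ C : ℝ, 0 < C ∧ ∀ L : ℝ, 0 < L →
      ∀ (u : EuclideanSpace ℝ (Fin n) → ℂ) (T : 𝓢'(EuclideanSpace ℝ (Fin n), ℂ)),
        MemLorentz p ∞ volume u → IsGivenBy T u → fourierSupport T ⊆ ball n (L * R) →
        supDeriv k distLinfty T ≤
          ENNReal.ofReal (C * L ^ ((k : ℝ) + n * (p⁻¹).toReal)) * lorentzNorm p ∞ volume u := by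
  obtain ⟨C, hC, H⟩ := exists_supDeriv_le (n := n) (k := k) (N := distLinfty)
    (X := ℝ × (EuclideanSpace ℝ (Fin n) → ℂ) × 𝓢'(EuclideanSpace ℝ (Fin n), ℂ))
    (τ := fun x => x.2.2)
    (P := fun x => 0 < x.1 ∧ MemLorentz p ∞ volume x.2.1 ∧ IsGivenBy x.2.2 x.2.1 ∧
      fourierSupport x.2.2 ⊆ ball n (x.1 * R))
    (B := fun x => ENNReal.ofReal (x.1 ^ k) * ENNReal.ofReal (x.1 ^ (n * (p⁻¹).toReal)) *
      lorentzNorm p ∞ volume x.2.1)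
    (fun α hα => by
      obtain ⟨m, hm⟩ := exists_multiDeriv_eq_multiplier hR α hα
      obtain ⟨C, hC, H⟩ := exists_distLinfty_multiplier_le hp m
      refine ⟨C, hC, fun ⟨L, u, T⟩ ⟨hL, hu, hT, hsupp⟩ => ?_⟩
      simp only at hL hu hT hsupp ⊢
      rw [hm L T hL hsupp]
      refine (H L _ u T hL hu hT).trans (le_of_eq ?_)
      rw [enorm_ofReal_pow hL]
      ring)
  refine ⟨C, hC, fun L hL u T hu hT hsupp => ?_⟩
  rw [ofReal_mul_pow_mul_rpow hC hL, mul_assoc]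
  exact H (L, u, T) ⟨hL, hu, hT, hsupp⟩

lemma exists_supDeriv_distLorentz_le_weak {R : ℝ} (hR : 0 < R) (n k : ℕ) (hp : 1 < p)
    (hpq : p < q) (hq : q < ∞) :
    ∃ C : ℝ, 0 < C ∧ ∀ L : ℝ, 0 < L →
      ∀ (u : EuclideanSpace ℝ (Fin n) → ℂ) (T : 𝓢'(EuclideanSpace ℝ (Fin n), ℂ)),
        MemLorentz p ∞ volume u → IsGivenBy T u → fourierSupport T ⊆ ball n (L * R) →
        supDeriv k (distLorentz q 1) T ≤
          ENNReal.ofReal (C * L ^ ((k : ℝ) + n * ((p⁻¹).toReal - (q⁻¹).toReal))) *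
            lorentzNorm p ∞ volume u := by
  obtain ⟨C, hC, H⟩ := exists_supDeriv_le (n := n) (k := k) (N := distLorentz q 1)
    (X := ℝ × (EuclideanSpace ℝ (Fin n) → ℂ) × 𝓢'(EuclideanSpace ℝ (Fin n), ℂ))
    (τ := fun x => x.2.2)
    (P := fun x => 0 < x.1 ∧ MemLorentz p ∞ volume x.2.1 ∧ IsGivenBy x.2.2 x.2.1 ∧
      fourierSupport x.2.2 ⊆ ball n (x.1 * R))
    (B := fun x => ENNReal.ofReal (x.1 ^ k) *
      ENNReal.ofReal (x.1 ^ (n * ((p⁻¹).toReal - (q⁻¹).toReal))) * lorentzNorm p ∞ volume x.2.1)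
    (fun α hα => by
      obtain ⟨m, hm⟩ := exists_multiDeriv_eq_multiplier hR α hα
      obtain ⟨C, hC, H⟩ := exists_distLorentz_multiplier_le_weak hp hpq hq.ne m
      refine ⟨C, hC, fun ⟨L, u, T⟩ ⟨hL, hu, hT, hsupp⟩ => ?_⟩
      simp only at hL hu hT hsupp ⊢
      rw [hm L T hL hsupp]
      refine (H L _ u T hL hu hT).trans (le_of_eq ?_)
      rw [enorm_ofReal_pow hL]
      ring)
  refine ⟨C, hC, fun L hL u T hu hT hsupp => ?_⟩
  rw [ofReal_mul_pow_mul_rpow hC hL, mul_assoc]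
  exact H (L, u, T) ⟨hL, hu, hT, hsupp⟩

/-- No integrability of `T` is needed: if `T` is not in `L^{q,l}`, the right-hand side is `∞`. -/
lemma exists_supDeriv_distLorentz_le {R : ℝ} (hR : 0 < R) (n k : ℕ) (hq : 1 < q) (hl : l ≠ 0) :
    ∃ C : ℝ, 0 < C ∧ ∀ (L : ℝ) (T : 𝓢'(EuclideanSpace ℝ (Fin n), ℂ)), 0 < L →
      fourierSupport T ⊆ ball n (L * R) →
        supDeriv k (distLorentz q l) T ≤ ENNReal.ofReal (C * L ^ k) * distLorentz q l T := by
  obtain ⟨C, hC, H⟩ := exists_supDeriv_le (n := n) (k := k) (N := distLorentz q l)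
    (X := ℝ × 𝓢'(EuclideanSpace ℝ (Fin n), ℂ)) (τ := fun x => x.2)
    (P := fun x => 0 < x.1 ∧ fourierSupport x.2 ⊆ ball n (x.1 * R))
    (B := fun x => ENNReal.ofReal (x.1 ^ k) * distLorentz q l x.2)
    (fun α hα => by
      obtain ⟨m, hm⟩ := exists_multiDeriv_eq_multiplier hR α hα
      obtain ⟨C, hC, H⟩ := exists_distLorentz_multiplier_le hq hl m
      refine ⟨C, hC, fun ⟨L, T⟩ ⟨hL, hsupp⟩ => ?_⟩
      simp only at hL hsupp ⊢
      rw [hm L T hL hsupp]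
      refine (H L _ T hL (by simp [hL.ne'])).trans (le_of_eq ?_)
      rw [enorm_ofReal_pow hL, mul_assoc])
  refine ⟨C, hC, fun L T hL hsupp => ?_⟩
  rw [ENNReal.ofReal_mul hC.le, mul_assoc]
  exact H (L, T) ⟨hL, hsupp⟩

lemma exists_distLorentz_le_supDeriv {r₁ r₂ : ℝ} (hr₁ : 0 < r₁) (hr : r₁ < r₂) (n k : ℕ)
    (hq : 1 < q) (hl : l ≠ 0) :
    ∃ C : ℝ, 0 < C ∧ ∀ (L : ℝ) (T : 𝓢'(EuclideanSpace ℝ (Fin n), ℂ)), 0 < L →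
      fourierSupport T ⊆ annulus n (L * r₁) (L * r₂) →
        ENNReal.ofReal (C⁻¹ * L ^ k) * distLorentz q l T ≤ supDeriv k (distLorentz q l) T := by
  obtain ⟨m, hm⟩ := exists_eq_sum_multiplier_multiDeriv hr₁ hr n k
  set s := Finset.piAntidiag (Finset.univ : Finset (Fin n)) k
  obtain ⟨D, hD, HD⟩ := exists_distLorentz_sum_le n q hl s
  choose A hA HA using fun α => exists_distLorentz_multiplier_le hq hl (m α)
  set M := D * ∑ α ∈ s, A α with hM
  have hMt : M ≠ ∞ := ENNReal.mul_ne_top hD (ENNReal.sum_ne_top.2 fun α _ => hA α)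
  refine ⟨M.toReal + 1, by positivity, fun L T hL hT => ?_⟩
  set Λ := supDeriv k (distLorentz q l) T with hΛ
  have hLk : 0 < L ^ k := pow_pos hL k
  have hC : 0 < M.toReal + 1 := by positivity
  have hmain : distLorentz q l T ≤
      ENNReal.ofReal (M.toReal + 1) * ENNReal.ofReal (L ^ k)⁻¹ * Λ := by
    conv_lhs => rw [hm L T hL hT]
    calc _ ≤ D * ∑ α ∈ s, A α * ENNReal.ofReal (L ^ k)⁻¹ * Λ := by
          refine (HD _).trans (mul_le_mul_right (Finset.sum_le_sum fun α hα => ?_) _)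
          refine (HA α L _ _ hL (by simp [hL.ne'])).trans ?_
          have hαk : ∑ i, α i = k := (Finset.mem_piAntidiag.1 hα).1
          have h1 : ‖(((L ^ k)⁻¹ : ℝ) : ℂ)‖ₑ = ENNReal.ofReal (L ^ k)⁻¹ := by
            rw [← ofReal_norm, Complex.norm_real, Real.norm_of_nonneg (by positivity)]
          rw [h1]
          exact mul_le_mul_right (le_iSup₂ (f := fun (α : Fin n → ℕ) (_ : ∑ i, α i = k) =>
            distLorentz q l (multiDeriv α T)) α hαk) _
      _ = M * ENNReal.ofReal (L ^ k)⁻¹ * Λ := by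
          rw [← Finset.sum_mul, ← Finset.sum_mul, hM]
          ring
      _ ≤ _ := by
          gcongr
          rw [ENNReal.ofReal_add ENNReal.toReal_nonneg zero_le_one, ENNReal.ofReal_toReal hMt]
          exact le_self_add
  calc ENNReal.ofReal ((M.toReal + 1)⁻¹ * L ^ k) * distLorentz q l T
      ≤ ENNReal.ofReal ((M.toReal + 1)⁻¹ * L ^ k) *
        (ENNReal.ofReal (M.toReal + 1) * ENNReal.ofReal (L ^ k)⁻¹ * Λ) := mul_le_mul_right hmain _
    _ = ENNReal.ofReal ((M.toReal + 1)⁻¹ * L ^ k * ((M.toReal + 1) * (L ^ k)⁻¹)) * Λ := by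
        rw [ENNReal.ofReal_mul (by positivity : 0 ≤ (M.toReal + 1)⁻¹ * L ^ k),
          ENNReal.ofReal_mul hC.le, ← mul_assoc]
    _ = Λ := by
        rw [show (M.toReal + 1)⁻¹ * L ^ k * ((M.toReal + 1) * (L ^ k)⁻¹) = 1 by field_simp,
          ENNReal.ofReal_one, one_mul]

end Bernstein

end LorentzBernstein

open LorentzBernstein in
/-- Bernstein inequalities in Lorentz spaces. The first conjunct says that the functions concerned
are tempered distributions; in the others `T` is the function `u` regarded as a tempered
distribution. -/
theorem lemma2p4 (n : ℕ) (hn : 1 ≤ n) (R r₁ r₂ : ℝ) (hR : 0 < R) (hr₁ : 0 < r₁) (hr : r₁ < r₂)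
    (k : ℕ) :
    (∀ p l : ℝ≥0∞, 1 < p → 0 < l → ∀ u : EuclideanSpace ℝ (Fin n) → ℂ,
      MemLorentz p l volume u → ∃ T : 𝓢'(EuclideanSpace ℝ (Fin n), ℂ), IsGivenBy T u) ∧
    (∀ p : ℝ≥0∞, 1 < p → ∃ C : ℝ, 0 < C ∧ ∀ L : ℝ, 0 < L →
      ∀ (u : EuclideanSpace ℝ (Fin n) → ℂ) (T : 𝓢'(EuclideanSpace ℝ (Fin n), ℂ)),
        MemLorentz p ∞ volume u → IsGivenBy T u → fourierSupport T ⊆ ball n (L * R) →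
        supDeriv k distLinfty T ≤
          ENNReal.ofReal (C * L ^ ((k : ℝ) + n * (p⁻¹).toReal)) * lorentzNorm p ∞ volume u) ∧
    (∀ p q : ℝ≥0∞, 1 < p → p < q → q < ∞ → ∃ C : ℝ, 0 < C ∧ ∀ L : ℝ, 0 < L →
      ∀ (u : EuclideanSpace ℝ (Fin n) → ℂ) (T : 𝓢'(EuclideanSpace ℝ (Fin n), ℂ)),
        MemLorentz p ∞ volume u → IsGivenBy T u → fourierSupport T ⊆ ball n (L * R) →
        supDeriv k (distLorentz q 1) T ≤
          ENNReal.ofReal (C * L ^ ((k : ℝ) + n * ((p⁻¹).toReal - (q⁻¹).toReal))) *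
            lorentzNorm p ∞ volume u) ∧
    (∀ q l : ℝ≥0∞, 1 < q → q < ∞ → 0 < l → ∃ C : ℝ, 0 < C ∧ ∀ L : ℝ, 0 < L →
      ∀ (u : EuclideanSpace ℝ (Fin n) → ℂ) (T : 𝓢'(EuclideanSpace ℝ (Fin n), ℂ)),
        (MemLorentz q l volume u ∨ ∃ p : ℝ≥0∞, 1 < p ∧ p < q ∧ MemLorentz p ∞ volume u) →
        IsGivenBy T u → fourierSupport T ⊆ ball n (L * R) →
        supDeriv k (distLorentz q l) T ≤
          ENNReal.ofReal (C * L ^ k) * lorentzNorm q l volume u) ∧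
    (∀ q l : ℝ≥0∞, 1 < q → q < ∞ → 0 < l → ∃ C : ℝ, 0 < C ∧ ∀ L : ℝ, 0 < L →
      ∀ (u : EuclideanSpace ℝ (Fin n) → ℂ) (T : 𝓢'(EuclideanSpace ℝ (Fin n), ℂ)),
        (MemLorentz q l volume u ∨ ∃ p : ℝ≥0∞, 1 < p ∧ p < q ∧ MemLorentz p ∞ volume u) →
        IsGivenBy T u → fourierSupport T ⊆ annulus n (L * r₁) (L * r₂) →
        ENNReal.ofReal (C⁻¹ * L ^ k) * lorentzNorm q l volume u ≤
            supDeriv k (distLorentz q l) T ∧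
          supDeriv k (distLorentz q l) T ≤
            ENNReal.ofReal (C * L ^ k) * lorentzNorm q l volume u) := by
  refine ⟨fun p l hp hl u hu => hu.exists_isGivenBy hp hl.ne',
    fun p hp => exists_supDeriv_distLinfty_le hR n k hp,
    fun p q hp hpq hq => exists_supDeriv_distLorentz_le_weak hR n k hp hpq hq,
    fun q l hq _ hl => ?_, fun q l hq _ hl => ?_⟩
  · obtain ⟨C, hC, H⟩ := exists_supDeriv_distLorentz_le hR n k hq hl.ne'
    refine ⟨C, hC, fun L hL u T _ hT hsupp => ?_⟩
    rw [← distLorentz_eq hT]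
    exact H L T hL hsupp
  · obtain ⟨C₁, hC₁, H₁⟩ := exists_supDeriv_distLorentz_le (hr₁.trans hr) n k hq hl.ne'
    obtain ⟨C₂, hC₂, H₂⟩ := exists_distLorentz_le_supDeriv hr₁ hr n k hq hl.ne'
    refine ⟨max C₁ C₂, lt_max_of_lt_left hC₁, fun L hL u T _ hT hsupp => ?_⟩
    rw [← distLorentz_eq hT]
    refine ⟨le_trans ?_ (H₂ L T hL hsupp),
      (H₁ L T hL fun ξ hξ => (hsupp hξ).2).trans ?_⟩
    · gcongr
      exact le_max_right _ _
    · gcongr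
      exact le_max_left _ _
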